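/- For integers $0\le i\le n$ with $i=0$ or $i$ odd, and $0\le k\le n$, put $$d^i_{n,k}=(-1)^n\frac{\sqrt{2n-2i+1}}{(-n)_i}\,\frac{(-n)_k(n-i+1)_k}{(1)_k(1)_k}\prod_{m=0}^{\frac{i-1}{2}}(n+k+1-2m)\prod_{m=0}^{\frac{i-3}{2}}(n-k-1-2m),$$ where $(a)_0=1$, $(a)_r=a(a+1)\cdots(a+r-1)$ for $r\ge 1$, and empty products equal $1$ (in particular both products equal $1$ when $i=0$). For $n\ge 0$ and $0\le i\le n$ let $h^n_{n-i}$ be the function on $[-1,1)$ given on $[0,1)$ by $$h^n_{n-i}(t)=\sum_{k=0}^n d^i_{n,k}t^k\quad(i=0\text{ or }i\text{ odd}),\qquad h^n_{n-i}(t)=\sum_{k=0}^{n-1} d^{i-1}_{n-1,k}t^k\quad(i>0\text{ even}),$$ and extended to $[-1,0)$ so that it is a polynomial there and satisfies $h^n_j(-t)=(-1)^{j+1}h^n_j(t)$ for $t\in(0,1)$. For $0\le j\le n$ let $\psi^n_j(t)=h^n_j(2t-1)\chi_{[0,1)}(t)$, that is, $\psi^n_j(t)=h^n_j(2t-1)$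 for $t\in[0,1)$ and $\psi^n_j(t)=0$ otherwise. Theorem. For every integer $n\ge 0$, the functions $$t\mapsto 2^{k/2}\,\psi^n_j(2^k t-i),\qquad i,k\in\mathbb Z,\ j=0,\dots,n,$$ are compactly supported and piecewise polynomial (with finitely many pieces), and they form an orthonormal basis of the Hilbert space $L^2(\mathbb R)$ (of real-valued functions, and also of complex-valued functions): they are orthonormal and their finite linear combinations are dense in $L^2(\mathbb R)$. -/

import Mathlib

open MeasureTheory

/-- The coefficient `d^i_{n,k}` (used for `i = 0` or `i` odd, `i ≤ n`, `0 ≤ k ≤ n`). Here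
`(ascPochhammer ℝ i).eval x` is the rising factorial `(x)_i = x (x + 1) ⋯ (x + i - 1)`.
For `i` odd the two products run over `0 ≤ m ≤ (i - 1) / 2` and `0 ≤ m ≤ (i - 3) / 2`;
for `i = 0` both are empty. -/
noncomputable def alpertCoeff (n i k : ℕ) : ℝ :=
  (-1) ^ n * (√(2 * (n : ℝ) - 2 * (i : ℝ) + 1) / (ascPochhammer ℝ i).eval (-(n : ℝ)))
    * ((ascPochhammer ℝ k).eval (-(n : ℝ)) * (ascPochhammer ℝ k).eval ((n : ℝ) - (i : ℝ) + 1)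
        / ((ascPochhammer ℝ k).eval 1 * (ascPochhammer ℝ k).eval 1))
    * (∏ m ∈ Finset.range ((i + 1) / 2), ((n : ℝ) + (k : ℝ) + 1 - 2 * (m : ℝ)))
    * (∏ m ∈ Finset.range ((i - 1) / 2), ((n : ℝ) - (k : ℝ) - 1 - 2 * (m : ℝ)))

open Classical in
/-- The polynomial with which `h^n_{n-i}` agrees on `[0, 1)`, for `0 ≤ i ≤ n`. -/
noncomputable def alpertPoly (n i : ℕ) : Polynomial ℝ :=
  if i = 0 ∨ Odd i then
    ∑ k ∈ Finset.range (n + 1), Polynomial.C (alpertCoeff n i k) * Polynomial.X ^ k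
  else
    ∑ k ∈ Finset.range n, Polynomial.C (alpertCoeff (n - 1) (i - 1) k) * Polynomial.X ^ k

open Classical in
/-- The function `h^n_j`, `0 ≤ j ≤ n`: the polynomial above on `[0, 1)`, extended to `[-1, 0)` by
the parity rule `h^n_j (-t) = (-1)^(j+1) h^n_j (t)`, and `0` outside of `[-1, 1)`. -/
noncomputable def alpertH (n j : ℕ) (t : ℝ) : ℝ :=
  if 0 ≤ t ∧ t < 1 then (alpertPoly n (n - j)).eval t
  else if -1 ≤ t ∧ t < 0 then (-1) ^ (j + 1) * (alpertPoly n (n - j)).eval (-t)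
  else 0

/-- The wavelet `ψ^n_j (t) = h^n_j (2 t - 1) χ_{[0,1)} (t)`. -/
noncomputable def alpertPsi (n j : ℕ) : ℝ → ℝ :=
  (Set.Ico (0 : ℝ) 1).indicator fun t => alpertH n j (2 * t - 1)

/-- The dilated and translated wavelet `t ↦ 2^{k/2} ψ^n_j (2^k t - i)`. -/
noncomputable def alpertWavelet (n : ℕ) (k i : ℤ) (j : Fin (n + 1)) (t : ℝ) : ℝ :=
  (2 : ℝ) ^ ((k : ℝ) / 2) * alpertPsi n j ((2 : ℝ) ^ k * t - (i : ℝ))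

/-- `f` is piecewise polynomial: there are finitely many break points such that `f` agrees with a
polynomial on each half-open interval `[a, b)` that has no break point in its interior. -/
def IsPiecewisePolynomial (f : ℝ → ℝ) : Prop :=
  ∃ S : Finset ℝ, ∀ a b : ℝ, a < b → (∀ s ∈ S, s ∉ Set.Ioo a b) →
    ∃ p : Polynomial ℝ, ∀ t ∈ Set.Ico a b, f t = p.eval t

/-!
For fixed `i` the coefficient `alpertCoeff n i k` is, up to a constant,
`(-1) ^ k * n.choose k * R k` with a polynomial `R` of degree at most `n`, so Lagrange interpolation of `R` at the nodes
`0, …, n` (`sum_choose_mul_eval_div`) evaluates the moments `∫₀¹ t ^ m * ∑ k, d_k t ^ k` in closed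
form: they are multiples of `R (-(m + 1))`. The factors of `R` show that the moments vanish for
`m < n - i`, and for odd `i` also whenever `m ≤ n` has the parity of `n`; other factors make the
coefficients `d_k` vanish for the `k > n - i` of the opposite parity. As `alpertPoly n i` for even `i > 0` has the coefficients that belong to
`(n - 1, i - 1)`, any two of the
polynomials `alpertPoly n i` with `i` of the same parity are orthonormal
(`unitIntegral_alpertPoly_mul`), and `h^n_j` is orthogonal to all polynomials of degree at most `n`
(`pairForm_restrictHalves_alpertPair`).

A function that is polynomial on both halves of a dyadic interval is encoded by a pair of
polynomials on `[0, 1)`. The shifted Legendre polynomials of degree at most `n` and the `n + 1`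
wavelets of the interval are `2 (n + 1)` orthogonal vectors among the pairs of degree at most `n`,
which form a space of that dimension, so they span it
(`exists_eq_sum_restrictHalves_add_sum_alpertPair`).

Orthonormality of the wavelets: at equal scales this is a computation on one interval, or the
supports are disjoint; at different scales the coarser wavelet is piecewise polynomial on the dyadic
grid, and a polynomial on a dyadic interval is refined to its halves until the scales agree
(`inner_dyadicLp_waveletLp`).

Completeness: by the spanning property, a polynomial on a dyadic interval is, modulo wavelets, a
polynomial on the parent interval, hence on any ancestor. Its Legendre coefficients there are
`O (2 ^ (-N / 2))` for the `N`-th ancestor, so a function orthogonal to all wavelets is orthogonal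
to all polynomials of degree at most `n` on dyadic intervals (`inner_dyadicLp_eq_zero`). In
particular its integral over each dyadic interval is `0`, and it vanishes almost everywhere by
Lebesgue's differentiation theorem (`ae_eq_zero_of_dyadic`).
-/

section

open Polynomial Filter Topology

/-! ### Partial fractions and the moments of the coefficient polynomials -/

/-- Partial fraction expansion of `R (-x) / (x (x + 1) ⋯ (x + n))`, obtained by interpolating `R`
at the nodes `0, …, n`. -/
theorem sum_choose_mul_eval_div (n : ℕ) (R : ℝ[X]) (hR : R.natDegree ≤ n) (x : ℝ) (hx : 0 < x) :
    ∑ k ∈ Finset.range (n + 1), (-1) ^ k * (n.choose k : ℝ) * R.eval (k : ℝ) / (x + k) =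
      n.factorial * R.eval (-x) / ∏ k ∈ Finset.range (n + 1), (x + k) := by
  have hinj : Set.InjOn (fun k : ℕ => (k : ℝ)) (Finset.range (n + 1)) :=
    fun a _ b _ h => Nat.cast_injective (R := ℝ) h
  have hdeg : R.degree < (Finset.range (n + 1)).card := by
    rw [Finset.card_range]
    exact lt_of_le_of_lt degree_le_natDegree (by exact_mod_cast Nat.lt_succ_of_le hR)
  have hnode : ∀ i ∈ Finset.range (n + 1), -x ≠ (fun k : ℕ => (k : ℝ)) i := by
    intro i _ h
    have : (0 : ℝ) ≤ i := Nat.cast_nonneg i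
    simp only at h
    linarith
  have key := congrArg (eval (-x)) (Lagrange.eq_interpolate hinj hdeg)
  rw [Lagrange.eval_interpolate_not_at_node _ hnode, Lagrange.eval_nodal] at key
  have hw : ∀ k ∈ Finset.range (n + 1),
      Lagrange.nodalWeight (Finset.range (n + 1)) (fun k : ℕ => (k : ℝ)) k =
        (-1) ^ n * (-1) ^ k * (n.choose k : ℝ) / n.factorial := by
    intro k hk
    have hkn : k ≤ n := Nat.lt_succ_iff.1 (Finset.mem_range.1 hk)
    have hsplit : (Finset.range (n + 1)).erase k =
        Finset.range k ∪ (Finset.range (n - k)).image (fun j => k + 1 + j) := by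
      ext a
      simp only [Finset.mem_erase, Finset.mem_range, Finset.mem_union, Finset.mem_image]
      constructor
      · rintro ⟨h1, h2⟩
        rcases lt_or_gt_of_ne h1 with h | h
        · exact Or.inl h
        · exact Or.inr ⟨a - (k + 1), by omega, by omega⟩
      · rintro (h | ⟨b, hb, rfl⟩) <;> omega
    have hdisj : Disjoint (Finset.range k) ((Finset.range (n - k)).image (fun j => k + 1 + j)) := by
      rw [Finset.disjoint_left]
      intro a ha hb
      simp only [Finset.mem_range, Finset.mem_image] at ha hb
      omega
    have h1 : ∏ j ∈ Finset.range k, ((k : ℝ) - j) = k.factorial := by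
      rw [← Finset.prod_range_reflect, ← Finset.prod_range_add_one_eq_factorial]
      push_cast
      refine Finset.prod_congr rfl fun j hj => ?_
      have := Finset.mem_range.1 hj
      rw [Nat.cast_sub (by omega), Nat.cast_sub (by omega)]
      push_cast
      ring
    have h2 : ∏ j ∈ Finset.range (n - k), ((k : ℝ) - ((k + 1 + j : ℕ) : ℝ)) =
        (-1) ^ (n - k) * (n - k).factorial := by
      rw [← Finset.prod_range_add_one_eq_factorial]
      push_cast
      rw [← Finset.card_range (n - k), ← Finset.prod_const, Finset.card_range,
        ← Finset.prod_mul_distrib]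
      exact Finset.prod_congr rfl fun j _ => by ring
    rw [Lagrange.nodalWeight, Finset.prod_inv_distrib, hsplit, Finset.prod_union hdisj,
      Finset.prod_image (fun a _ b _ h => by simpa using h), h1, h2, Nat.cast_choose ℝ hkn]
    have hsign : (-1 : ℝ) ^ n * (-1) ^ k = (-1) ^ (n - k) := by
      obtain ⟨m, rfl⟩ := Nat.exists_eq_add_of_le hkn
      rw [Nat.add_sub_cancel_left, pow_add]
      have : ((-1 : ℝ) ^ k) * (-1) ^ k = 1 := by rw [← mul_pow]; norm_num
      linear_combination (-1 : ℝ) ^ m * this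
    rw [hsign]
    have hs : ((-1 : ℝ) ^ (n - k)) * (-1) ^ (n - k) = 1 := by rw [← mul_pow]; norm_num
    have a1 := Nat.factorial_ne_zero k
    have a2 := Nat.factorial_ne_zero n
    have a3 := Nat.factorial_ne_zero (n - k)
    field_simp
    linear_combination -hs
  have hprod : ∏ k ∈ Finset.range (n + 1), (-x - (k : ℝ)) =
      (-1) ^ (n + 1) * ∏ k ∈ Finset.range (n + 1), (x + k) := by
    rw [← Finset.card_range (n + 1), ← Finset.prod_const, Finset.card_range,
      ← Finset.prod_mul_distrib]
    exact Finset.prod_congr rfl fun j _ => by ring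
  have hpos : ∏ k ∈ Finset.range (n + 1), (x + (k : ℝ)) ≠ 0 :=
    Finset.prod_ne_zero_iff.2 fun k _ => by positivity
  have hn : (n.factorial : ℝ) ≠ 0 := by exact_mod_cast Nat.factorial_ne_zero n
  have hsum : ∑ k ∈ Finset.range (n + 1),
      Lagrange.nodalWeight (Finset.range (n + 1)) (fun k : ℕ => (k : ℝ)) k *
        (-x - (k : ℝ))⁻¹ * eval (k : ℝ) R =
      (-1) ^ (n + 1) / n.factorial *
      ∑ k ∈ Finset.range (n + 1), (-1) ^ k * (n.choose k : ℝ) * R.eval (k : ℝ) / (x + k) := by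
    rw [Finset.mul_sum]
    refine Finset.sum_congr rfl fun k hk => ?_
    rw [hw k hk]
    have h1 : (x + (k : ℝ)) ≠ 0 := by positivity
    have h2 : -x - (k : ℝ) = -(x + k) := by ring
    rw [h2, inv_neg]
    field_simp
    ring
  rw [hsum, hprod] at key
  have hs : ((-1 : ℝ) ^ (n + 1)) * (-1) ^ (n + 1) = 1 := by rw [← mul_pow]; norm_num
  rw [key, eq_div_iff hpos]
  field_simp
  linear_combination -(∑ k ∈ Finset.range (n + 1),
    (-1) ^ k * (n.choose k : ℝ) * R.eval (k : ℝ) / (x + k)) * hs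

/-- The polynomial factor of `alpertCoeff n i k` in the variable `k`: up to a constant,
`alpertCoeff n i k` is `(-1) ^ k * n.choose k * R k`, where `R` is this polynomial. Its degree is at most `n`. -/
noncomputable def alpertFactor (n i : ℕ) : ℝ[X] :=
  C (((n - i).factorial : ℝ)⁻¹) * (ascPochhammer ℝ (n - i)).comp (X + 1)
    * (∏ m ∈ Finset.range ((i + 1) / 2), (X + C ((n : ℝ) + 1 - 2 * (m : ℝ))))
    * (∏ m ∈ Finset.range ((i - 1) / 2), (C ((n : ℝ) - 1 - 2 * (m : ℝ)) - X))

/-- The factor of `alpertCoeff n i k` that does not depend on `k`. -/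
noncomputable def alpertConst (n i : ℕ) : ℝ :=
  (-1) ^ n * (√(2 * (n : ℝ) - 2 * (i : ℝ) + 1) / (ascPochhammer ℝ i).eval (-(n : ℝ)))

theorem alpertFactor_eval (n i : ℕ) (x : ℝ) : (alpertFactor n i).eval x =
    ((n - i).factorial : ℝ)⁻¹ * (ascPochhammer ℝ (n - i)).eval (x + 1)
    * (∏ m ∈ Finset.range ((i + 1) / 2), ((n : ℝ) + x + 1 - 2 * (m : ℝ)))
    * (∏ m ∈ Finset.range ((i - 1) / 2), ((n : ℝ) - x - 1 - 2 * (m : ℝ))) := by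
  simp only [alpertFactor, Polynomial.eval_mul, Polynomial.eval_prod, Polynomial.eval_C,
    Polynomial.eval_comp, Polynomial.eval_add, Polynomial.eval_sub, Polynomial.eval_X,
    Polynomial.eval_one]
  congr 1
  · congr 1
    exact Finset.prod_congr rfl fun m _ => by ring
  · exact Finset.prod_congr rfl fun m _ => by ring

theorem natDegree_alpertFactor_le (n i : ℕ) (hi : i ≤ n) : (alpertFactor n i).natDegree ≤ n := by
  have h0 : (C (((n - i).factorial : ℝ)⁻¹) : ℝ[X]).natDegree ≤ 0 := by simp
  have h1 : ((ascPochhammer ℝ (n - i)).comp (X + 1)).natDegree ≤ n - i := by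
    refine natDegree_comp_le.trans ?_
    rw [ascPochhammer_natDegree]
    have : (X + 1 : ℝ[X]).natDegree = 1 := by simpa using natDegree_X_add_C (1 : ℝ)
    rw [this, mul_one]
  have h2 : (∏ m ∈ Finset.range ((i + 1) / 2), (X + C ((n : ℝ) + 1 - 2 * (m : ℝ)))).natDegree
      ≤ (i + 1) / 2 := by
    refine (natDegree_prod_le _ _).trans ?_
    simp only [natDegree_X_add_C, Finset.sum_const, Finset.card_range, smul_eq_mul, mul_one,
      le_refl]
  have h3 : (∏ m ∈ Finset.range ((i - 1) / 2), (C ((n : ℝ) - 1 - 2 * (m : ℝ)) - X)).natDegree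
      ≤ (i - 1) / 2 := by
    refine (natDegree_prod_le _ _).trans ?_
    refine (Finset.sum_le_card_nsmul _ _ 1 fun m _ => ?_).trans (by simp)
    exact (natDegree_sub_le _ _).trans (by rw [natDegree_C, natDegree_X]; simp)
  have h4 := natDegree_mul_le_of_le (natDegree_mul_le_of_le (natDegree_mul_le_of_le h0 h1) h2) h3
  refine h4.trans ?_
  omega

theorem ascPochhammer_eval_neg_natCast (n k : ℕ) :
    (ascPochhammer ℝ k).eval (-(n : ℝ)) = (-1) ^ k * (n.descFactorial k : ℝ) := by
  rw [ascPochhammer_eval_neg_eq_descPochhammer, descPochhammer_eval_eq_descFactorial]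

theorem ascPochhammer_eval_natCast_add_one (n k : ℕ) :
    (ascPochhammer ℝ k).eval ((n : ℝ) + 1) = ((n + k).factorial : ℝ) / n.factorial := by
  have h : ((n : ℝ) + 1) = ((n + 1 : ℕ) : ℝ) := by push_cast; rfl
  rw [h, ← ascPochhammer_eval_cast, ascPochhammer_nat_eq_ascFactorial,
    eq_div_iff (by exact_mod_cast Nat.factorial_ne_zero n), ← Nat.factorial_mul_ascFactorial]
  push_cast
  ring

theorem alpertCoeff_eq (n i k : ℕ) (hi : i ≤ n) :
    alpertCoeff n i k =
      alpertConst n i * ((-1) ^ k * (n.choose k : ℝ) * (alpertFactor n i).eval (k : ℝ)) := by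
  have h1 : (ascPochhammer ℝ k).eval 1 = (k.factorial : ℝ) := by
    simpa only [Nat.cast_zero, zero_add, Nat.factorial_zero, Nat.cast_one, div_one] using
      ascPochhammer_eval_natCast_add_one 0 k
  have h2 : (n.descFactorial k : ℝ) = k.factorial * n.choose k := by
    exact_mod_cast Nat.descFactorial_eq_factorial_mul_choose n k
  have h3 : ((n : ℝ) - i + 1) = ((n - i : ℕ) : ℝ) + 1 := by rw [Nat.cast_sub hi]
  rw [alpertCoeff, alpertConst, alpertFactor_eval, ascPochhammer_eval_neg_natCast n k, h1, h2, h3,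
    ascPochhammer_eval_natCast_add_one, ascPochhammer_eval_natCast_add_one, add_comm k (n - i)]
  have a1 : (k.factorial : ℝ) ≠ 0 := by exact_mod_cast Nat.factorial_ne_zero k
  field_simp

/-- Integration over `[0, 1]`, as a linear functional on polynomials. -/
noncomputable def unitIntegral : Polynomial ℝ →ₗ[ℝ] ℝ where
  toFun p := ∫ x in (0 : ℝ)..1, p.eval x
  map_add' p q := by
    simp only [Polynomial.eval_add]
    exact intervalIntegral.integral_add (p.continuous.intervalIntegrable _ _)
      (q.continuous.intervalIntegrable _ _)
  map_smul' c p := by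
    simp only [Polynomial.eval_smul, smul_eq_mul, RingHom.id_apply]
    exact intervalIntegral.integral_const_mul _ _

theorem unitIntegral_apply (p : Polynomial ℝ) :
    unitIntegral p = ∫ x in (0 : ℝ)..1, p.eval x := rfl

theorem unitIntegral_X_pow (m : ℕ) : unitIntegral (Polynomial.X ^ m) = 1 / ((m : ℝ) + 1) := by
  simp [unitIntegral_apply, integral_pow]

/-- The polynomial with coefficients `alpertCoeff n i`. -/
noncomputable def alpertBasePoly (n i : ℕ) : ℝ[X] :=
  ∑ k ∈ Finset.range (n + 1), C (alpertCoeff n i k) * X ^ k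

theorem unitIntegral_mul_alpertBasePoly_eq_sum (n i : ℕ) (p : ℝ[X]) :
    unitIntegral (p * alpertBasePoly n i) =
      ∑ k ∈ Finset.range (n + 1), alpertCoeff n i k * unitIntegral (p * X ^ k) := by
  rw [alpertBasePoly, Finset.mul_sum, map_sum]
  refine Finset.sum_congr rfl fun k _ => ?_
  rw [← smul_eq_C_mul, mul_smul_comm, map_smul, smul_eq_mul]

/-- The moments of `alpertBasePoly n i`. -/
theorem unitIntegral_X_pow_mul_alpertBasePoly (n i m : ℕ) (hi : i ≤ n) :
    unitIntegral (X ^ m * alpertBasePoly n i) =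
      alpertConst n i * (n.factorial * (alpertFactor n i).eval (-((m : ℝ) + 1)) /
        ∏ k ∈ Finset.range (n + 1), ((m : ℝ) + 1 + k)) := by
  rw [unitIntegral_mul_alpertBasePoly_eq_sum, ← sum_choose_mul_eval_div n _
    (natDegree_alpertFactor_le n i hi) ((m : ℝ) + 1) (by positivity), Finset.mul_sum]
  refine Finset.sum_congr rfl fun k _ => ?_
  rw [← pow_add, unitIntegral_X_pow, alpertCoeff_eq n i k hi]
  push_cast
  have : (m : ℝ) + 1 + k ≠ 0 := by positivity
  have : (m : ℝ) + k + 1 ≠ 0 := by positivity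
  field_simp
  ring

theorem unitIntegral_X_pow_mul_alpertBasePoly_of_lt {n i m : ℕ} (hi : i ≤ n) (hm : m < n - i) :
    unitIntegral (X ^ m * alpertBasePoly n i) = 0 := by
  have h : -((m : ℝ) + 1) + 1 = -(m : ℝ) := by ring
  rw [unitIntegral_X_pow_mul_alpertBasePoly n i m hi, alpertFactor_eval, h,
    ascPochhammer_eval_neg_coe_nat_of_lt hm]
  simp

theorem unitIntegral_X_pow_mul_alpertBasePoly_of_even {n i m : ℕ} (hi : i ≤ n) (hodd : Odd i)
    (hm : m ≤ n) (hpar : Even (n - m)) : unitIntegral (X ^ m * alpertBasePoly n i) = 0 := by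
  rcases lt_or_ge m (n - i) with h | h
  · exact unitIntegral_X_pow_mul_alpertBasePoly_of_lt hi h
  obtain ⟨a, ha⟩ := hpar
  obtain ⟨s, hs⟩ := hodd
  have hmem : a ∈ Finset.range ((i + 1) / 2) := Finset.mem_range.2 (by omega)
  have hz : (n : ℝ) + -((m : ℝ) + 1) + 1 - 2 * (a : ℝ) = 0 := by
    have : (n : ℝ) = m + 2 * a := by exact_mod_cast (by omega : n = m + 2 * a)
    rw [this]; ring
  rw [unitIntegral_X_pow_mul_alpertBasePoly n i m hi, alpertFactor_eval,
    Finset.prod_eq_zero hmem hz]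
  simp

theorem alpertCoeff_eq_zero {n i k : ℕ} (hi : i ≤ n) (hodd : Odd i) (hk : n - i < k) (hkn : k ≤ n)
    (hpar : ¬ Even (n - k)) : alpertCoeff n i k = 0 := by
  rw [Nat.not_even_iff_odd] at hpar
  obtain ⟨a, ha⟩ := hpar
  obtain ⟨s, hs⟩ := hodd
  have hmem : a ∈ Finset.range ((i - 1) / 2) := Finset.mem_range.2 (by omega)
  have hz : (n : ℝ) - k - 1 - 2 * (a : ℝ) = 0 := by
    have : (n : ℝ) = k + 2 * a + 1 := by exact_mod_cast (by omega : n = k + 2 * a + 1)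
    rw [this]; ring
  rw [alpertCoeff, Finset.prod_eq_zero hmem hz, mul_zero]

/-- Interlacing a product of `s + 1` numbers `x, x - 2, …` with the `s` numbers
`x - 1, x - 3, …` in between gives the rising factorial ending at `x`. -/
theorem prod_mul_prod_mul_factorial (x s : ℕ) :
    (∏ a ∈ Finset.range (s + 1), ((x : ℝ) + 2 * s + 1 - 2 * (a : ℝ))) *
      (∏ a ∈ Finset.range s, ((x : ℝ) + 2 * s - 2 * (a : ℝ))) * x.factorial =
      (x + 2 * s + 1).factorial := by
  induction s with
  | zero => simp [Nat.factorial_succ]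
  | succ s ih =>
    rw [Finset.prod_range_succ' _ (s + 1), Finset.prod_range_succ'
      (fun a : ℕ => (x : ℝ) + 2 * ((s + 1 : ℕ) : ℝ) - 2 * (a : ℝ)) s]
    have e : x + 2 * (s + 1) + 1 = (x + 2 * s + 1) + 1 + 1 := by ring
    rw [e, Nat.factorial_succ, Nat.factorial_succ, Nat.cast_mul, Nat.cast_mul, ← ih]
    have h1 : ∏ k ∈ Finset.range (s + 1), ((x : ℝ) + 2 * ((s + 1 : ℕ) : ℝ) + 1 -
        2 * ((k + 1 : ℕ) : ℝ)) = ∏ a ∈ Finset.range (s + 1), ((x : ℝ) + 2 * s + 1 - 2 * a) :=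
      Finset.prod_congr rfl fun k _ => by push_cast; ring
    have h2 : ∏ k ∈ Finset.range s, ((x : ℝ) + 2 * ((s + 1 : ℕ) : ℝ) -
        2 * ((k + 1 : ℕ) : ℝ)) = ∏ a ∈ Finset.range s, ((x : ℝ) + 2 * s - 2 * a) :=
      Finset.prod_congr rfl fun k _ => by push_cast; ring
    rw [h1, h2]
    push_cast
    ring

/-- The values of `alpertFactor` that enter the normalisation of `alpertBasePoly (l + i) i`. -/
theorem alpertFactor_eval_mul_eval (l i : ℕ) (hi : i = 0 ∨ Odd i) :
    (alpertFactor (l + i) i).eval (l : ℝ) * (alpertFactor (l + i) i).eval (-((l : ℝ) + 1)) *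
      ((2 * l + 1).factorial * (l.factorial) ^ 2) =
      (-1) ^ l * (2 * l).factorial * i.factorial * (2 * l + i + 1).factorial := by
  have h0 : (ascPochhammer ℝ l).eval ((l : ℝ) + 1) = ((2 * l).factorial : ℝ) / l.factorial := by
    rw [ascPochhammer_eval_natCast_add_one, two_mul]
  have h1 : (ascPochhammer ℝ l).eval (-((l : ℝ) + 1) + 1) = (-1) ^ l * l.factorial := by
    have : -((l : ℝ) + 1) + 1 = -(l : ℝ) := by ring
    rw [this, ascPochhammer_eval_neg_natCast, Nat.descFactorial_self]
  have a1 : (l.factorial : ℝ) ≠ 0 := by exact_mod_cast Nat.factorial_ne_zero l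
  rw [alpertFactor_eval, alpertFactor_eval, Nat.add_sub_cancel, h0, h1]
  rcases hi with rfl | ⟨s, rfl⟩
  · simp
    field_simp
  · have e1 : (2 * s + 1 + 1) / 2 = s + 1 := by omega
    have e2 : (2 * s + 1 - 1) / 2 = s := by omega
    rw [e1, e2]
    have hA := prod_mul_prod_mul_factorial 0 s
    have hB := prod_mul_prod_mul_factorial (2 * l + 1) s
    have p1 : ∏ m ∈ Finset.range (s + 1), (((l + (2 * s + 1) : ℕ) : ℝ) + l + 1 - 2 * (m : ℝ)) =
        ∏ a ∈ Finset.range (s + 1), (((2 * l + 1 : ℕ) : ℝ) + 2 * s + 1 - 2 * (a : ℝ)) :=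
      Finset.prod_congr rfl fun m _ => by push_cast; ring
    have p2 : ∏ m ∈ Finset.range s, (((l + (2 * s + 1) : ℕ) : ℝ) - l - 1 - 2 * (m : ℝ)) =
        ∏ a ∈ Finset.range s, (((0 : ℕ) : ℝ) + 2 * s - 2 * (a : ℝ)) :=
      Finset.prod_congr rfl fun m _ => by push_cast; ring
    have p3 : ∏ m ∈ Finset.range (s + 1),
        (((l + (2 * s + 1) : ℕ) : ℝ) + -((l : ℝ) + 1) + 1 - 2 * (m : ℝ)) =
        ∏ a ∈ Finset.range (s + 1), (((0 : ℕ) : ℝ) + 2 * s + 1 - 2 * (a : ℝ)) :=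
      Finset.prod_congr rfl fun m _ => by push_cast; ring
    have p4 : ∏ m ∈ Finset.range s,
        (((l + (2 * s + 1) : ℕ) : ℝ) - -((l : ℝ) + 1) - 1 - 2 * (m : ℝ)) =
        ∏ a ∈ Finset.range s, (((2 * l + 1 : ℕ) : ℝ) + 2 * s - 2 * (a : ℝ)) :=
      Finset.prod_congr rfl fun m _ => by push_cast; ring
    have f1 : 2 * l + (2 * s + 1) + 1 = 2 * l + 1 + 2 * s + 1 := by ring
    have f2 : 0 + 2 * s + 1 = 2 * s + 1 := by ring
    rw [f2, Nat.factorial_zero, Nat.cast_one, mul_one] at hA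
    rw [p1, p2, p3, p4, f1, ← hA, ← hB]
    field_simp

/-- In the square norm of `alpertBasePoly n i` all terms but that of `t ^ (n - i)` vanish; this one
is `1`. -/
theorem alpertCoeff_mul_unitIntegral (n i : ℕ) (hi : i ≤ n) (hi' : i = 0 ∨ Odd i) :
    alpertCoeff n i (n - i) * unitIntegral (X ^ (n - i) * alpertBasePoly n i) = 1 := by
  obtain ⟨l, rfl⟩ := Nat.exists_eq_add_of_le' hi
  rw [alpertCoeff_eq _ _ _ hi, unitIntegral_X_pow_mul_alpertBasePoly _ _ _ hi, Nat.add_sub_cancel]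
  have key := alpertFactor_eval_mul_eval l i hi'
  have hprod : ∏ k ∈ Finset.range (l + i + 1), ((l : ℝ) + 1 + k) =
      ((2 * l + i + 1).factorial : ℝ) / l.factorial := by
    have h : ∀ r : ℕ, ∏ k ∈ Finset.range r, ((l : ℝ) + 1 + k) =
        (ascPochhammer ℝ r).eval ((l : ℝ) + 1) := by
      intro r
      induction r with
      | zero => simp
      | succ r ih => rw [Finset.prod_range_succ, ih, ascPochhammer_succ_eval]
    rw [h, ascPochhammer_eval_natCast_add_one, two_mul, add_assoc, add_assoc, add_assoc]
  have hconst : alpertConst (l + i) i ^ 2 =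
      (2 * l + 1) * ((l.factorial : ℝ) / (l + i).factorial) ^ 2 := by
    have hd : ((l + i).descFactorial i : ℝ) = (l + i).factorial / l.factorial := by
      rw [eq_div_iff (by exact_mod_cast Nat.factorial_ne_zero l)]
      have := Nat.factorial_mul_descFactorial hi
      rw [Nat.add_sub_cancel] at this
      rw [← this]; push_cast; ring
    have hs : (2 * ((l + i : ℕ) : ℝ) - 2 * (i : ℝ) + 1) = 2 * l + 1 := by push_cast; ring
    have hsq : √(2 * (l : ℝ) + 1) ^ 2 = 2 * l + 1 := Real.sq_sqrt (by positivity)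
    have o1 : ((-1 : ℝ) ^ (l + i)) ^ 2 = 1 := by rw [← pow_mul, mul_comm, pow_mul]; norm_num
    have o2 : ((-1 : ℝ) ^ i) ^ 2 = 1 := by rw [← pow_mul, mul_comm, pow_mul]; norm_num
    rw [alpertConst, ascPochhammer_eval_neg_natCast, hd, hs, mul_pow, div_pow, mul_pow, hsq, o1, o2]
    have a1 : (l.factorial : ℝ) ≠ 0 := by exact_mod_cast Nat.factorial_ne_zero l
    have a2 : ((l + i).factorial : ℝ) ≠ 0 := by exact_mod_cast Nat.factorial_ne_zero (l + i)
    field_simp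
  have hch : ((l + i).choose l : ℝ) = (l + i).factorial / (l.factorial * i.factorial) := by
    rw [Nat.cast_add_choose]
  have hfac : ((2 * l + 1).factorial : ℝ) = (2 * l + 1) * (2 * l).factorial := by
    rw [Nat.factorial_succ]; push_cast; ring
  rw [hprod, hch]
  have a1 : (l.factorial : ℝ) ≠ 0 := by exact_mod_cast Nat.factorial_ne_zero l
  have a2 : ((l + i).factorial : ℝ) ≠ 0 := by exact_mod_cast Nat.factorial_ne_zero (l + i)
  have a3 : (i.factorial : ℝ) ≠ 0 := by exact_mod_cast Nat.factorial_ne_zero i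
  have a4 : ((2 * l + i + 1).factorial : ℝ) ≠ 0 := by
    exact_mod_cast Nat.factorial_ne_zero (2 * l + i + 1)
  have a5 : ((2 * l).factorial : ℝ) ≠ 0 := by exact_mod_cast Nat.factorial_ne_zero (2 * l)
  have hl : (2 * (l : ℝ) + 1) ≠ 0 := by positivity
  have o : (-1 : ℝ) ^ l * (-1) ^ l = 1 := by rw [← mul_pow]; norm_num
  set A := (alpertFactor (l + i) i).eval (l : ℝ)
  set B := (alpertFactor (l + i) i).eval (-((l : ℝ) + 1))
  have hAB : A * B = (-1) ^ l * i.factorial * (2 * l + i + 1).factorial /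
      ((2 * l + 1) * l.factorial ^ 2) := by
    rw [eq_div_iff (by positivity)]
    rw [hfac] at key
    refine mul_right_cancel₀ a5 ?_
    linear_combination key
  have : alpertConst (l + i) i ^ 2 * (A * B) * ((-1) ^ l * (l + i).factorial ^ 2) =
      i.factorial * (2 * l + i + 1).factorial := by
    rw [hconst, hAB]
    field_simp
    linear_combination o
  field_simp
  linear_combination this

/-! ### The polynomials `alpertPoly` on the unit interval -/

theorem natDegree_alpertBasePoly_le (n i : ℕ) : (alpertBasePoly n i).natDegree ≤ n := by
  refine natDegree_sum_le_of_forall_le _ _ fun k hk => ?_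
  exact (natDegree_C_mul_X_pow_le _ _).trans (Nat.lt_succ_iff.1 (Finset.mem_range.1 hk))

theorem unitIntegral_mul_alpertBasePoly_of_coeff {n i : ℕ} {p : ℝ[X]}
    (h : ∀ m, p.coeff m ≠ 0 → unitIntegral (X ^ m * alpertBasePoly n i) = 0) :
    unitIntegral (p * alpertBasePoly n i) = 0 := by
  conv_lhs => rw [p.as_sum_range_C_mul_X_pow, Finset.sum_mul, map_sum]
  refine Finset.sum_eq_zero fun m _ => ?_
  rw [mul_assoc, ← smul_eq_C_mul, map_smul, smul_eq_mul]
  by_cases hm : p.coeff m = 0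
  · rw [hm, zero_mul]
  · rw [h m hm, mul_zero]

/-- For `i = 0` the base polynomial of degree `n` is a shifted Legendre polynomial. -/
theorem unitIntegral_mul_alpertBasePoly_zero {n : ℕ} {p : ℝ[X]} (hp : p.natDegree < n) :
    unitIntegral (p * alpertBasePoly n 0) = 0 := by
  refine unitIntegral_mul_alpertBasePoly_of_coeff fun m hm => ?_
  exact unitIntegral_X_pow_mul_alpertBasePoly_of_lt n.zero_le
    ((le_natDegree_of_ne_zero hm).trans_lt (by simpa using hp))

theorem unitIntegral_alpertBasePoly_mul_self {n i : ℕ} (hi : i ≤ n) (hi' : i = 0 ∨ Odd i) :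
    unitIntegral (alpertBasePoly n i * alpertBasePoly n i) = 1 := by
  rw [unitIntegral_mul_alpertBasePoly_eq_sum, Finset.sum_eq_single (n - i),
    mul_comm _ (X ^ (n - i))]
  · exact alpertCoeff_mul_unitIntegral n i hi hi'
  · intro k hk hne
    have hkn : k ≤ n := Nat.lt_succ_iff.1 (Finset.mem_range.1 hk)
    rw [mul_comm _ (X ^ k)]
    rcases lt_or_gt_of_ne hne with h | h
    · rw [unitIntegral_X_pow_mul_alpertBasePoly_of_lt hi h, mul_zero]
    · rcases hi' with rfl | hodd
      · omega
      · by_cases hpar : Even (n - k)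
        · rw [unitIntegral_X_pow_mul_alpertBasePoly_of_even hi hodd hkn hpar, mul_zero]
        · rw [alpertCoeff_eq_zero hi hodd h hkn hpar, zero_mul]
  · intro h
    exact absurd (Finset.mem_range.2 (by omega)) h

theorem unitIntegral_alpertBasePoly_mul_of_lt {n i i' : ℕ} (hlt : i < i') (hi : i' ≤ n)
    (h : Odd i) (h' : Odd i') :
    unitIntegral (alpertBasePoly n i * alpertBasePoly n i') = 0 := by
  rw [unitIntegral_mul_alpertBasePoly_eq_sum]
  refine Finset.sum_eq_zero fun k hk => ?_
  have hkn : k ≤ n := Nat.lt_succ_iff.1 (Finset.mem_range.1 hk)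
  rw [mul_comm _ (X ^ k)]
  by_cases hpar : Even (n - k)
  · rw [unitIntegral_X_pow_mul_alpertBasePoly_of_even (hlt.le.trans hi) h hkn hpar, mul_zero]
  · rcases le_or_gt k (n - i') with hk' | hk'
    · rw [unitIntegral_X_pow_mul_alpertBasePoly_of_lt (hlt.le.trans hi) (by omega), mul_zero]
    · rw [alpertCoeff_eq_zero hi h' hk' hkn hpar, zero_mul]

theorem unitIntegral_alpertBasePoly_mul {n i i' : ℕ} (hi : i ≤ n) (hi' : i' ≤ n)
    (h : Odd i) (h' : Odd i') :
    unitIntegral (alpertBasePoly n i * alpertBasePoly n i') = if i = i' then 1 else 0 := by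
  split_ifs with he
  · subst he
    exact unitIntegral_alpertBasePoly_mul_self hi (Or.inr h)
  · rcases lt_or_gt_of_ne he with hlt | hlt
    · exact unitIntegral_alpertBasePoly_mul_of_lt hlt hi' h h'
    · rw [mul_comm]
      exact unitIntegral_alpertBasePoly_mul_of_lt hlt hi h' h

theorem unitIntegral_legendre_mul (m m' : ℕ) :
    unitIntegral (alpertBasePoly m 0 * alpertBasePoly m' 0) = if m = m' then 1 else 0 := by
  split_ifs with he
  · subst he
    exact unitIntegral_alpertBasePoly_mul_self m.zero_le (Or.inl rfl)
  · rcases lt_or_gt_of_ne he with hlt | hlt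
    · exact unitIntegral_mul_alpertBasePoly_zero ((natDegree_alpertBasePoly_le m 0).trans_lt hlt)
    · rw [mul_comm]
      exact unitIntegral_mul_alpertBasePoly_zero ((natDegree_alpertBasePoly_le m' 0).trans_lt hlt)

theorem alpertPoly_of_zero_or_odd {n i : ℕ} (h : i = 0 ∨ Odd i) :
    alpertPoly n i = alpertBasePoly n i := by
  rw [alpertPoly, if_pos h, alpertBasePoly]

theorem alpertPoly_of_even {n i : ℕ} (h0 : i ≠ 0) (h : ¬ Odd i) (hi : i ≤ n) :
    alpertPoly n i = alpertBasePoly (n - 1) (i - 1) := by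
  rw [alpertPoly, if_neg (by tauto), alpertBasePoly, Nat.sub_add_cancel (by omega)]

theorem natDegree_alpertPoly_le {n i : ℕ} (hi : i ≤ n) : (alpertPoly n i).natDegree ≤ n := by
  by_cases h : i = 0 ∨ Odd i
  · rw [alpertPoly_of_zero_or_odd h]
    exact natDegree_alpertBasePoly_le n i
  · push Not at h
    rw [alpertPoly_of_even h.1 (by simpa using h.2) hi]
    exact (natDegree_alpertBasePoly_le _ _).trans (Nat.sub_le _ _)

theorem unitIntegral_alpertPoly_mul {n i i' : ℕ} (hi : i ≤ n) (hi' : i' ≤ n)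
    (hpar : Even i ↔ Even i') :
    unitIntegral (alpertPoly n i * alpertPoly n i') = if i = i' then 1 else 0 := by
  by_cases ho : Odd i
  · have ho' : Odd i' := by
      rw [← Nat.not_even_iff_odd] at ho ⊢
      tauto
    rw [alpertPoly_of_zero_or_odd (Or.inr ho), alpertPoly_of_zero_or_odd (Or.inr ho'),
      unitIntegral_alpertBasePoly_mul hi hi' ho ho']
  have ho' : ¬ Odd i' := by
    rw [Nat.not_odd_iff_even] at ho ⊢
    tauto
  have hlow : ∀ {r : ℕ}, r ≠ 0 → ¬ Odd r → r ≤ n →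
      unitIntegral (alpertPoly n r * alpertPoly n 0) = 0 := by
    intro r hr hro hrn
    rw [alpertPoly_of_even hr hro hrn, alpertPoly_of_zero_or_odd (Or.inl rfl)]
    exact unitIntegral_mul_alpertBasePoly_zero
      ((natDegree_alpertBasePoly_le _ _).trans_lt (by omega))
  rcases eq_or_ne i 0 with rfl | hi0 <;> rcases eq_or_ne i' 0 with rfl | hi0'
  · rw [alpertPoly_of_zero_or_odd (Or.inl rfl), unitIntegral_legendre_mul]
    simp
  · rw [mul_comm, hlow hi0' ho' hi', if_neg hi0'.symm]
  · rw [hlow hi0 ho hi, if_neg hi0]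
  · rw [alpertPoly_of_even hi0 ho hi, alpertPoly_of_even hi0' ho' hi']
    rw [Nat.not_odd_iff_even] at ho ho'
    rw [unitIntegral_alpertBasePoly_mul (by omega) (by omega)
      (Nat.Even.sub_odd (by omega) ho odd_one) (Nat.Even.sub_odd (by omega) ho' odd_one)]
    congr 1
    rw [eq_iff_iff]
    omega

theorem unitIntegral_X_pow_mul_alpertPoly {n i m : ℕ} (hi : i ≤ n) (hm : m ≤ n)
    (hpar : Odd (m + (n - i))) : unitIntegral (X ^ m * alpertPoly n i) = 0 := by
  by_cases ho : Odd i
  · rw [alpertPoly_of_zero_or_odd (Or.inr ho)]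
    refine unitIntegral_X_pow_mul_alpertBasePoly_of_even hi ho hm ?_
    rw [Nat.odd_iff] at ho hpar
    rw [Nat.even_iff]
    omega
  rcases eq_or_ne i 0 with rfl | hi0
  · rw [alpertPoly_of_zero_or_odd (Or.inl rfl)]
    refine unitIntegral_X_pow_mul_alpertBasePoly_of_lt hi ?_
    rw [Nat.odd_iff] at hpar
    omega
  · rw [alpertPoly_of_even hi0 ho hi]
    rw [Nat.odd_iff] at ho hpar
    refine unitIntegral_X_pow_mul_alpertBasePoly_of_even (by omega) ?_ (by omega) ?_
    · rw [Nat.odd_iff]; omega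
    · rw [Nat.even_iff]; omega

theorem unitIntegral_mul_alpertPoly_of_parity {n j : ℕ} (hj : j ≤ n) {r : ℝ[X]}
    (hr : r.natDegree ≤ n) (hpar : r.comp (-X) = C ((-1) ^ (j + 1)) * r) :
    unitIntegral (r * alpertPoly n (n - j)) = 0 := by
  rw [r.as_sum_range_C_mul_X_pow, Finset.sum_mul, map_sum]
  refine Finset.sum_eq_zero fun m hm => ?_
  have hmn : m ≤ n := (Nat.lt_succ_iff.1 (Finset.mem_range.1 hm)).trans hr
  rw [mul_assoc, ← smul_eq_C_mul, map_smul, smul_eq_mul]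
  by_cases ho : Odd (m + (n - (n - j)))
  · rw [unitIntegral_X_pow_mul_alpertPoly (Nat.sub_le _ _) hmn ho, mul_zero]
  · have hc := congrArg (fun p => coeff p m) hpar
    have hX : (-X : ℝ[X]) = C (-1) * X := by simp
    simp only [hX, comp_C_mul_X_coeff, coeff_C_mul] at hc
    have hsgn : (-1 : ℝ) ^ (j + 1) = - (-1) ^ m := by
      rw [Nat.sub_sub_self hj, Nat.not_odd_iff_even, Nat.even_add] at ho
      rcases Nat.even_or_odd m with h | h
      · rw [pow_succ, h.neg_one_pow, (ho.1 h).neg_one_pow]; ring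
      · have hj' : Odd j := by rw [← Nat.not_even_iff_odd] at h ⊢; tauto
        rw [pow_succ, h.neg_one_pow, hj'.neg_one_pow]; ring
    rw [hsgn] at hc
    have hne : ((-1 : ℝ) ^ m) ≠ 0 := pow_ne_zero _ (by norm_num)
    have : r.coeff m = 0 := by
      have h2 : (-1 : ℝ) ^ m * r.coeff m = 0 := by linarith
      exact (mul_eq_zero.1 h2).resolve_left hne
    rw [this, zero_mul]

/-! ### Pairs of polynomials on the two halves of the unit interval -/

theorem unitIntegral_comp_one_sub (p : ℝ[X]) : unitIntegral (p.comp (1 - X)) = unitIntegral p := by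
  have h := intervalIntegral.integral_comp_sub_left (a := (0 : ℝ)) (b := 1) (fun x => p.eval x) 1
  simpa [unitIntegral_apply] using h

/-- A polynomial on `[0, 1)`, seen as the pair of its restrictions to `[0, 1/2)` and `[1/2, 1)`,
each rescaled to `[0, 1)`. -/
noncomputable def restrictHalves (p : ℝ[X]) : ℝ[X] × ℝ[X] :=
  (p.comp (C (1 / 2) * X), p.comp (C (1 / 2) * (X + 1)))

theorem unitIntegral_restrictHalves (p : ℝ[X]) :
    unitIntegral (restrictHalves p).1 + unitIntegral (restrictHalves p).2 =
      2 * unitIntegral p := by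
  simp only [restrictHalves, unitIntegral_apply, eval_comp, eval_mul, eval_C, eval_X, eval_add,
    eval_one]
  have h1 := intervalIntegral.integral_comp_mul_left (a := (0 : ℝ)) (b := 1)
    (fun x => p.eval x) (c := 1 / 2) (by norm_num)
  have h2 := intervalIntegral.integral_comp_mul_add (a := (0 : ℝ)) (b := 1)
    (fun x => p.eval x) (c := 1 / 2) (by norm_num) (1 / 2)
  have h3 := intervalIntegral.integral_add_adjacent_intervals
    (p.continuous.intervalIntegrable (μ := volume) 0 (1 / 2))
    (p.continuous.intervalIntegrable (1 / 2) 1)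
  have e : ∀ x : ℝ, 1 / 2 * (x + 1) = 1 / 2 * x + 1 / 2 := fun x => by ring
  simp only [e]
  rw [h1, h2, ← h3]
  norm_num
  ring

/-- The inner product, up to a factor `2`, of the functions on `[0, 1)` that two pairs of
polynomials describe. -/
noncomputable def pairForm : ℝ[X] × ℝ[X] →ₗ[ℝ] ℝ[X] × ℝ[X] →ₗ[ℝ] ℝ :=
  LinearMap.mk₂ ℝ (fun u v => unitIntegral (u.1 * v.1) + unitIntegral (u.2 * v.2))
    (fun u u' v => by simp only [Prod.fst_add, Prod.snd_add, add_mul, map_add]; ring)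
    (fun c u v => by
      simp only [Prod.smul_fst, Prod.smul_snd, smul_mul_assoc, map_smul, smul_eq_mul]; ring)
    (fun u v v' => by simp only [Prod.fst_add, Prod.snd_add, mul_add, map_add]; ring)
    (fun c u v => by
      simp only [Prod.smul_fst, Prod.smul_snd, mul_smul_comm, map_smul, smul_eq_mul]; ring)

theorem pairForm_apply (u v : ℝ[X] × ℝ[X]) :
    pairForm u v = unitIntegral (u.1 * v.1) + unitIntegral (u.2 * v.2) := rfl

theorem pairForm_comm (u v : ℝ[X] × ℝ[X]) : pairForm u v = pairForm v u := by
  rw [pairForm_apply, pairForm_apply, mul_comm u.1, mul_comm u.2]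

theorem pairForm_restrictHalves (p q : ℝ[X]) :
    pairForm (restrictHalves p) (restrictHalves q) = 2 * unitIntegral (p * q) := by
  rw [← unitIntegral_restrictHalves, pairForm_apply]
  simp only [restrictHalves, mul_comp]

/-- The pair of polynomials that describes the wavelet `alpertPsi n j`. -/
noncomputable def alpertPair (n j : ℕ) : ℝ[X] × ℝ[X] :=
  (C ((-1) ^ (j + 1)) * (alpertPoly n (n - j)).comp (1 - X), alpertPoly n (n - j))

theorem pairForm_alpertPair {n j j' : ℕ} (hj : j ≤ n) (hj' : j' ≤ n) :
    pairForm (alpertPair n j) (alpertPair n j') = 2 * if j = j' then 1 else 0 := by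
  have e : (alpertPair n j).1 * (alpertPair n j').1 = ((-1 : ℝ) ^ (j + j')) •
      (alpertPoly n (n - j) * alpertPoly n (n - j')).comp (1 - X) := by
    simp only [alpertPair, mul_comp, smul_eq_C_mul]
    have : (-1 : ℝ) ^ (j + j') = (-1) ^ (j + 1) * (-1) ^ (j' + 1) := by ring
    rw [this, C_mul]
    ring
  rw [pairForm_apply, e, map_smul, unitIntegral_comp_one_sub, smul_eq_mul]
  change _ + unitIntegral (alpertPoly n (n - j) * alpertPoly n (n - j')) = _
  rcases Nat.even_or_odd (j + j') with h | h
  · have hpar : Even (n - j) ↔ Even (n - j') := by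
      rw [Nat.even_iff, Nat.even_iff]
      rw [Nat.even_iff] at h
      omega
    have hiff : n - j = n - j' ↔ j = j' := by omega
    rw [unitIntegral_alpertPoly_mul (Nat.sub_le _ _) (Nat.sub_le _ _) hpar, h.neg_one_pow,
      if_congr hiff rfl rfl]
    ring
  · have hne : j ≠ j' := by
      rintro rfl
      rw [Nat.odd_iff] at h
      omega
    rw [h.neg_one_pow, if_neg hne]
    ring

/-- The wavelets are orthogonal to the polynomials of degree at most `n`. -/
theorem pairForm_restrictHalves_alpertPair {n j : ℕ} (hj : j ≤ n) {q : ℝ[X]}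
    (hq : q.natDegree ≤ n) : pairForm (restrictHalves q) (alpertPair n j) = 0 := by
  -- reflecting the left half turns the form into one integral against a polynomial of the
  -- parity of `alpertH n j`
  set r : ℝ[X] := C ((-1) ^ (j + 1)) * q.comp (C (1 / 2) * (1 - X)) +
    q.comp (C (1 / 2) * (X + 1)) with hr
  have hs : ((-1 : ℝ) ^ (j + 1)) * (-1) ^ (j + 1) = 1 := by rw [← mul_pow]; norm_num
  have hdeg : r.natDegree ≤ n := by
    have d1 : (C (1 / 2 : ℝ) * (1 - X)).natDegree ≤ 1 := by compute_degree
    have d2 : (C (1 / 2 : ℝ) * (X + 1)).natDegree ≤ 1 := by compute_degree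
    refine natDegree_add_le_of_degree_le ((natDegree_C_mul_le _ _).trans ?_) ?_
    · exact natDegree_comp_le.trans ((Nat.mul_le_mul hq d1).trans (by simp))
    · exact natDegree_comp_le.trans ((Nat.mul_le_mul hq d2).trans (by simp))
  have hpar : r.comp (-X) = C ((-1) ^ (j + 1)) * r := by
    have e1 : (C (1 / 2 : ℝ) * (1 - X)).comp (-X) = C (1 / 2) * (X + 1) := by
      simp only [mul_comp, C_comp, sub_comp, one_comp, X_comp]; ring
    have e2 : (C (1 / 2 : ℝ) * (X + 1)).comp (-X) = C (1 / 2) * (1 - X) := by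
      simp only [mul_comp, C_comp, add_comp, one_comp, X_comp]; ring
    rw [hr, add_comp, mul_comp, C_comp, comp_assoc, comp_assoc, e1, e2,
      mul_add (C _) (C _ * _), ← mul_assoc (C _) (C _), ← C_mul, hs, C_1, one_mul, add_comm]
  have key := unitIntegral_mul_alpertPoly_of_parity hj hdeg hpar
  have hflip : unitIntegral (q.comp (C (1 / 2) * X) *
      (C ((-1) ^ (j + 1)) * (alpertPoly n (n - j)).comp (1 - X))) =
      unitIntegral (C ((-1) ^ (j + 1)) * q.comp (C (1 / 2) * (1 - X)) *
        alpertPoly n (n - j)) := by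
    rw [← unitIntegral_comp_one_sub]
    congr 1
    have e3 : (1 - X : ℝ[X]).comp (1 - X) = X := by
      simp only [sub_comp, one_comp, X_comp]; ring
    simp only [mul_comp, C_comp, comp_assoc, X_comp, e3, comp_X]
    ring
  rw [pairForm_apply]
  change unitIntegral (q.comp (C (1 / 2) * X) *
    (C ((-1) ^ (j + 1)) * (alpertPoly n (n - j)).comp (1 - X))) +
    unitIntegral (q.comp (C (1 / 2) * (X + 1)) * alpertPoly n (n - j)) = 0
  rw [hflip, ← map_add, ← add_mul]
  exact key

theorem natDegree_restrictHalves_le {n : ℕ} {p : ℝ[X]} (hp : p.natDegree ≤ n) :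
    (restrictHalves p).1.natDegree ≤ n ∧ (restrictHalves p).2.natDegree ≤ n := by
  have d1 : (C (1 / 2 : ℝ) * X).natDegree ≤ 1 := by compute_degree
  have d2 : (C (1 / 2 : ℝ) * (X + 1)).natDegree ≤ 1 := by compute_degree
  exact ⟨natDegree_comp_le.trans ((Nat.mul_le_mul hp d1).trans (by simp)),
    natDegree_comp_le.trans ((Nat.mul_le_mul hp d2).trans (by simp))⟩

theorem natDegree_alpertPair_le {n j : ℕ} :
    (alpertPair n j).1.natDegree ≤ n ∧ (alpertPair n j).2.natDegree ≤ n := by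
  have h : (alpertPoly n (n - j)).natDegree ≤ n := natDegree_alpertPoly_le (Nat.sub_le _ _)
  have d1 : (1 - X : ℝ[X]).natDegree ≤ 1 := by compute_degree
  exact ⟨(natDegree_C_mul_le _ _).trans
    (natDegree_comp_le.trans ((Nat.mul_le_mul h d1).trans (by simp))), h⟩

/-- The polynomials and the wavelets span all pairs: they are `2 (n + 1)` orthogonal vectors of a
space of dimension `2 (n + 1)`. -/
theorem exists_eq_sum_restrictHalves_add_sum_alpertPair {n : ℕ} (u : ℝ[X] × ℝ[X])
    (h1 : u.1.natDegree ≤ n) (h2 : u.2.natDegree ≤ n) :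
    ∃ a b : Fin (n + 1) → ℝ, u = ∑ m, a m • restrictHalves (alpertBasePoly m 0) +
      ∑ j : Fin (n + 1), b j • alpertPair n j := by
  let v : Fin (n + 1) ⊕ Fin (n + 1) → ℝ[X] × ℝ[X] :=
    Sum.elim (fun m => restrictHalves (alpertBasePoly m 0)) (fun j => alpertPair n j)
  have hle : ∀ m : Fin (n + 1), (m : ℕ) ≤ n := fun m => Nat.lt_succ_iff.1 m.2
  have hdeg : ∀ m : Fin (n + 1), (alpertBasePoly m 0).natDegree ≤ n :=
    fun m => (natDegree_alpertBasePoly_le _ _).trans (hle m)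
  have hortho : pairForm.IsOrthoᵢ v := by
    rintro (m | j) (m' | j') hne
    · have : (m : ℕ) ≠ m' := fun h => hne (congrArg Sum.inl (Fin.ext h))
      change pairForm (restrictHalves _) (restrictHalves _) = 0
      rw [pairForm_restrictHalves, unitIntegral_legendre_mul, if_neg this, mul_zero]
    · exact pairForm_restrictHalves_alpertPair (hle j') (hdeg m)
    · change pairForm _ _ = 0
      rw [pairForm_comm]
      exact pairForm_restrictHalves_alpertPair (hle j) (hdeg m')
    · have : (j : ℕ) ≠ j' := fun h => hne (congrArg Sum.inr (Fin.ext h))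
      change pairForm (alpertPair _ _) (alpertPair _ _) = 0
      rw [pairForm_alpertPair (hle j) (hle j'), if_neg this, mul_zero]
  have hself : ∀ s, pairForm (v s) (v s) ≠ 0 := by
    rintro (m | j)
    · change pairForm (restrictHalves _) (restrictHalves _) ≠ 0
      rw [pairForm_restrictHalves, unitIntegral_legendre_mul, if_pos rfl]
      norm_num
    · change pairForm (alpertPair _ _) (alpertPair _ _) ≠ 0
      rw [pairForm_alpertPair (hle j) (hle j), if_pos rfl]
      norm_num
  have hlin : LinearIndependent ℝ v := LinearMap.linearIndependent_of_isOrthoᵢ hortho hself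
  have hmem : ∀ p : ℝ[X], p.natDegree ≤ n → p ∈ degreeLT ℝ (n + 1) := fun p hp => by
    rw [mem_degreeLT]
    exact degree_le_natDegree.trans_lt (by exact_mod_cast Nat.lt_succ_of_le hp)
  have hv : ∀ s, (v s).1.natDegree ≤ n ∧ (v s).2.natDegree ≤ n := by
    rintro (m | j)
    · exact natDegree_restrictHalves_le (hdeg m)
    · exact natDegree_alpertPair_le
  let w : Fin (n + 1) ⊕ Fin (n + 1) → degreeLT ℝ (n + 1) × degreeLT ℝ (n + 1) :=
    fun s => (⟨(v s).1, hmem _ (hv s).1⟩, ⟨(v s).2, hmem _ (hv s).2⟩)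
  let f : degreeLT ℝ (n + 1) × degreeLT ℝ (n + 1) →ₗ[ℝ] ℝ[X] × ℝ[X] :=
    (degreeLT ℝ (n + 1)).subtype.prodMap (degreeLT ℝ (n + 1)).subtype
  have hw : LinearIndependent ℝ w := LinearIndependent.of_comp f hlin
  have hfin : Module.Finite ℝ (degreeLT ℝ (n + 1)) :=
    Module.Finite.equiv (degreeLTEquiv ℝ (n + 1)).symm
  have hrank : Module.finrank ℝ (degreeLT ℝ (n + 1)) = n + 1 := by
    rw [(degreeLTEquiv ℝ (n + 1)).finrank_eq]
    simp
  have htop := hw.span_eq_top_of_card_eq_finrank' (by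
    rw [Module.finrank_prod, hrank]
    simp)
  obtain ⟨c, hc⟩ := (Submodule.mem_span_range_iff_exists_fun ℝ).1
    (htop ▸ Submodule.mem_top : ((⟨u.1, hmem _ h1⟩, ⟨u.2, hmem _ h2⟩) :
      degreeLT ℝ (n + 1) × degreeLT ℝ (n + 1)) ∈ Submodule.span ℝ (Set.range w))
  refine ⟨fun m => c (Sum.inl m), fun j => c (Sum.inr j), ?_⟩
  have := congrArg f hc
  rw [map_sum] at this
  simp only [map_smul, Fintype.sum_sum_type] at this
  exact this.symm

/-! ### Scaling functions in `L²` -/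

/-- The polynomial `p` on `[0, 1)`, extended by `0`. -/
noncomputable def unitBump (p : ℝ[X]) : ℝ → ℝ :=
  (Set.Ico (0 : ℝ) 1).indicator fun x => p.eval x

theorem unitBump_of_mem {p : ℝ[X]} {x : ℝ} (h0 : 0 ≤ x) (h1 : x < 1) : unitBump p x = p.eval x :=
  Set.indicator_of_mem (Set.mem_Ico.2 ⟨h0, h1⟩) _

theorem unitBump_of_neg {p : ℝ[X]} {x : ℝ} (h : x < 0) : unitBump p x = 0 :=
  Set.indicator_of_notMem (fun hx => absurd (Set.mem_Ico.1 hx).1 (not_le.2 h)) _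

theorem unitBump_of_one_le {p : ℝ[X]} {x : ℝ} (h : 1 ≤ x) : unitBump p x = 0 :=
  Set.indicator_of_notMem (fun hx => absurd (Set.mem_Ico.1 hx).2 (not_lt.2 h)) _

theorem unitBump_mul (p q : ℝ[X]) (x : ℝ) : unitBump (p * q) x = unitBump p x * unitBump q x := by
  simp only [unitBump, eval_mul]
  exact congrFun (Set.indicator_mul _ _ _) x

theorem unitBump_add (p q : ℝ[X]) (x : ℝ) : unitBump (p + q) x = unitBump p x + unitBump q x := by
  simp only [unitBump, eval_add]
  exact congrFun (Set.indicator_add _ _ _) x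

theorem unitBump_smul (c : ℝ) (p : ℝ[X]) (x : ℝ) : unitBump (c • p) x = c * unitBump p x := by
  simp only [unitBump, eval_smul, smul_eq_mul]
  exact Set.indicator_const_mul _ _ _ _

theorem measurable_unitBump (p : ℝ[X]) : Measurable (unitBump p) :=
  p.continuous.measurable.indicator measurableSet_Ico

theorem exists_abs_unitBump_le (p : ℝ[X]) : ∃ M : ℝ, ∀ x, |unitBump p x| ≤ M := by
  obtain ⟨M, hM⟩ := (isCompact_Icc (a := (0 : ℝ)) (b := 1)).exists_bound_of_continuousOn
    p.continuous.continuousOn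
  have hM0 : 0 ≤ M := (norm_nonneg _).trans (hM 0 (by simp))
  refine ⟨M, fun x => ?_⟩
  rcases lt_or_ge x 0 with h | h
  · rwa [unitBump_of_neg h, abs_zero]
  rcases lt_or_ge x 1 with h' | h'
  · rw [unitBump_of_mem h h']
    exact hM x ⟨h, h'.le⟩
  · rwa [unitBump_of_one_le h', abs_zero]

theorem integral_unitBump (p : ℝ[X]) : ∫ x, unitBump p x = unitIntegral p := by
  rw [unitIntegral_apply, intervalIntegral.integral_of_le zero_le_one, unitBump,
    integral_indicator measurableSet_Ico, integral_Ico_eq_integral_Ioo,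
    integral_Ioc_eq_integral_Ioo]

theorem unitBump_eq_restrictHalves (p : ℝ[X]) (x : ℝ) :
    unitBump p x = unitBump (restrictHalves p).1 (2 * x) +
      unitBump (restrictHalves p).2 (2 * x - 1) := by
  rcases lt_or_ge x 0 with h0 | h0
  · rw [unitBump_of_neg h0, unitBump_of_neg (by linarith), unitBump_of_neg (by linarith), add_zero]
  rcases lt_or_ge x 1 with h1 | h1
  swap
  · rw [unitBump_of_one_le h1, unitBump_of_one_le (by linarith), unitBump_of_one_le (by linarith),
      add_zero]
  rw [unitBump_of_mem h0 h1]
  rcases lt_or_ge (2 * x) 1 with h | h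
  · rw [unitBump_of_mem (by linarith) h, unitBump_of_neg (by linarith), add_zero, restrictHalves,
      eval_comp]
    congr 1
    simp
  · rw [unitBump_of_one_le h, unitBump_of_mem (by linarith) (by linarith), zero_add,
      restrictHalves, eval_comp]
    congr 1
    simp

theorem alpertPsi_eq (n j : ℕ) (x : ℝ) :
    alpertPsi n j x = unitBump (alpertPair n j).1 (2 * x) +
      unitBump (alpertPair n j).2 (2 * x - 1) := by
  rcases lt_or_ge x 0 with h0 | h0
  · rw [unitBump_of_neg (by linarith), unitBump_of_neg (by linarith), add_zero, alpertPsi,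
      Set.indicator_of_notMem fun hx => absurd (Set.mem_Ico.1 hx).1 (not_le.2 h0)]
  rcases lt_or_ge x 1 with h1 | h1
  swap
  · rw [unitBump_of_one_le (by linarith), unitBump_of_one_le (by linarith), add_zero, alpertPsi,
      Set.indicator_of_notMem fun hx => absurd (Set.mem_Ico.1 hx).2 (not_lt.2 h1)]
  rw [alpertPsi, Set.indicator_of_mem (Set.mem_Ico.2 ⟨h0, h1⟩), alpertH]
  rcases lt_or_ge (2 * x) 1 with h | h
  · rw [unitBump_of_mem (by linarith) h, unitBump_of_neg (by linarith), add_zero,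
      if_neg (fun hx => by linarith [hx.1]), if_pos ⟨by linarith, by linarith⟩, alpertPair,
      eval_mul, eval_C, eval_comp]
    congr 2
    simp
  · rw [unitBump_of_one_le h, unitBump_of_mem (by linarith) (by linarith), zero_add,
      if_pos ⟨by linarith, by linarith⟩, alpertPair]

theorem two_rpow_half_mul_self (k : ℤ) :
    (2 : ℝ) ^ ((k : ℝ) / 2) * (2 : ℝ) ^ ((k : ℝ) / 2) = (2 : ℝ) ^ k := by
  rw [← Real.rpow_add two_pos, add_halves, Real.rpow_intCast]

theorem two_rpow_half_add_one (k : ℤ) :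
    (2 : ℝ) ^ (((k + 1 : ℤ) : ℝ) / 2) = √2 * (2 : ℝ) ^ ((k : ℝ) / 2) := by
  rw [Real.sqrt_eq_rpow, ← Real.rpow_add two_pos]
  congr 1
  push_cast
  ring

/-- The polynomial `p`, placed on the dyadic interval `[i / 2 ^ k, (i + 1) / 2 ^ k)` and
normalised in `L²`. -/
noncomputable def dyadicBump (k i : ℤ) (p : ℝ[X]) (t : ℝ) : ℝ :=
  (2 : ℝ) ^ ((k : ℝ) / 2) * unitBump p ((2 : ℝ) ^ k * t - i)

theorem dyadicBump_child (k i : ℤ) (p q : ℝ[X]) (t : ℝ) :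
    (√2)⁻¹ * (dyadicBump (k + 1) (2 * i) p t + dyadicBump (k + 1) (2 * i + 1) q t) =
      (2 : ℝ) ^ ((k : ℝ) / 2) * (unitBump p (2 * ((2 : ℝ) ^ k * t - i)) +
        unitBump q (2 * ((2 : ℝ) ^ k * t - i) - 1)) := by
  have e1 : (2 : ℝ) ^ (k + 1) * t - ((2 * i : ℤ) : ℝ) = 2 * ((2 : ℝ) ^ k * t - i) := by
    rw [zpow_add_one₀ two_ne_zero]; push_cast; ring
  have e2 : (2 : ℝ) ^ (k + 1) * t - ((2 * i + 1 : ℤ) : ℝ) = 2 * ((2 : ℝ) ^ k * t - i) - 1 := by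
    rw [zpow_add_one₀ two_ne_zero]; push_cast; ring
  have h2 : (√2 : ℝ) ≠ 0 := by positivity
  rw [dyadicBump, dyadicBump, e1, e2, two_rpow_half_add_one]
  field_simp

theorem dyadicBump_refine (k i : ℤ) (p : ℝ[X]) (t : ℝ) :
    dyadicBump k i p t = (√2)⁻¹ * (dyadicBump (k + 1) (2 * i) (restrictHalves p).1 t +
      dyadicBump (k + 1) (2 * i + 1) (restrictHalves p).2 t) := by
  rw [dyadicBump_child, ← unitBump_eq_restrictHalves, dyadicBump]

theorem alpertWavelet_eq (n : ℕ) (k i : ℤ) (j : Fin (n + 1)) (t : ℝ) :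
    alpertWavelet n k i j t = (√2)⁻¹ * (dyadicBump (k + 1) (2 * i) (alpertPair n j).1 t +
      dyadicBump (k + 1) (2 * i + 1) (alpertPair n j).2 t) := by
  rw [dyadicBump_child, ← alpertPsi_eq, alpertWavelet]

theorem measurable_dyadicBump (k i : ℤ) (p : ℝ[X]) : Measurable (dyadicBump k i p) :=
  ((measurable_unitBump p).comp ((measurable_id.const_mul _).sub_const _)).const_mul _

theorem dyadicBump_eq_zero {k i : ℤ} {p : ℝ[X]} {t : ℝ}
    (h : t ∉ Set.Icc ((i : ℝ) / 2 ^ k) (((i : ℝ) + 1) / 2 ^ k)) : dyadicBump k i p t = 0 := by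
  have hk : (0 : ℝ) < 2 ^ k := zpow_pos two_pos k
  rw [Set.mem_Icc, not_and_or, not_le, not_le, lt_div_iff₀ hk, div_lt_iff₀ hk] at h
  rcases h with h | h
  · rw [dyadicBump, unitBump_of_neg (by linarith), mul_zero]
  · rw [dyadicBump, unitBump_of_one_le (by linarith), mul_zero]

theorem abs_dyadicBump_le {p : ℝ[X]} {M : ℝ} (hM : ∀ x, |unitBump p x| ≤ M) (k i : ℤ) (t : ℝ) :
    |dyadicBump k i p t| ≤ (2 : ℝ) ^ ((k : ℝ) / 2) * M := by
  rw [dyadicBump, abs_mul, abs_of_pos (Real.rpow_pos_of_pos two_pos _)]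
  exact mul_le_mul_of_nonneg_left (hM _) (Real.rpow_pos_of_pos two_pos _).le

theorem memLp_dyadicBump (k i : ℤ) (p : ℝ[X]) (r : ENNReal) : MemLp (dyadicBump k i p) r := by
  obtain ⟨M, hM⟩ := exists_abs_unitBump_le p
  have hind : dyadicBump k i p = (Set.Icc ((i : ℝ) / 2 ^ k) (((i : ℝ) + 1) / 2 ^ k)).indicator
      (dyadicBump k i p) := by
    ext t
    by_cases h : t ∈ Set.Icc ((i : ℝ) / 2 ^ k) (((i : ℝ) + 1) / 2 ^ k)
    · rw [Set.indicator_of_mem h]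
    · rw [Set.indicator_of_notMem h, dyadicBump_eq_zero h]
  rw [hind, memLp_indicator_iff_restrict measurableSet_Icc]
  exact MemLp.of_bound (measurable_dyadicBump k i p).aestronglyMeasurable _
    (Filter.Eventually.of_forall fun t => abs_dyadicBump_le hM k i t)

theorem integral_dyadicBump_mul (k i : ℤ) (p q : ℝ[X]) :
    ∫ t, dyadicBump k i p t * dyadicBump k i q t = unitIntegral (p * q) := by
  have hk : (0 : ℝ) < 2 ^ k := zpow_pos two_pos k
  have e : ∀ t, dyadicBump k i p t * dyadicBump k i q t =
      (2 : ℝ) ^ k * unitBump (p * q) ((2 : ℝ) ^ k * t - i) := fun t => by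
    rw [dyadicBump, dyadicBump, unitBump_mul, ← two_rpow_half_mul_self]; ring
  simp only [e]
  rw [integral_const_mul, Measure.integral_comp_mul_left (fun s => unitBump (p * q) (s - i)),
    integral_sub_right_eq_self (unitBump (p * q)), integral_unitBump, abs_of_pos (inv_pos.2 hk),
    smul_eq_mul, mul_inv_cancel_left₀ hk.ne']

theorem dyadicBump_mul_of_ne {k i i' : ℤ} (h : i ≠ i') (p q : ℝ[X]) (t : ℝ) :
    dyadicBump k i p t * dyadicBump k i' q t = 0 := by
  wlog hlt : i < i' generalizing i i' p q
  · rw [mul_comm]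
    exact this h.symm q p (lt_of_le_of_ne (not_lt.1 hlt) h.symm)
  have h1 : (i : ℝ) + 1 ≤ i' := by exact_mod_cast hlt
  rcases lt_or_ge ((2 : ℝ) ^ k * t - i') 0 with h0 | h0
  · rw [dyadicBump, dyadicBump, unitBump_of_neg h0, mul_zero, mul_zero]
  · rw [dyadicBump, unitBump_of_one_le (by linarith), mul_zero, zero_mul]

section Lp

variable (𝕜 : Type*) [RCLike 𝕜]

/-- `dyadicBump` as an element of `L²`. -/
noncomputable def dyadicLp (k i : ℤ) (p : ℝ[X]) : Lp 𝕜 2 (volume : Measure ℝ) :=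
  (memLp_dyadicBump k i p 2).ofReal.toLp fun t => (dyadicBump k i p t : 𝕜)

theorem coeFn_dyadicLp (k i : ℤ) (p : ℝ[X]) :
    (dyadicLp 𝕜 k i p : ℝ → 𝕜) =ᵐ[volume] fun t => (dyadicBump k i p t : 𝕜) :=
  MemLp.coeFn_toLp _

theorem inner_dyadicLp_left (k i : ℤ) (p : ℝ[X]) (f : Lp 𝕜 2 (volume : Measure ℝ)) :
    inner 𝕜 (dyadicLp 𝕜 k i p) f = ∫ t, (dyadicBump k i p t : 𝕜) * f t := by
  rw [L2.inner_def]
  refine integral_congr_ae ?_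
  filter_upwards [coeFn_dyadicLp 𝕜 k i p] with t ht
  rw [ht, RCLike.inner_apply, RCLike.conj_ofReal, mul_comm]

theorem inner_dyadicLp_dyadicLp (k i k' i' : ℤ) (p q : ℝ[X]) :
    inner 𝕜 (dyadicLp 𝕜 k i p) (dyadicLp 𝕜 k' i' q) =
      ((∫ t, dyadicBump k i p t * dyadicBump k' i' q t : ℝ) : 𝕜) := by
  rw [inner_dyadicLp_left, ← integral_ofReal]
  refine integral_congr_ae ?_
  filter_upwards [coeFn_dyadicLp 𝕜 k' i' q] with t ht
  rw [ht, RCLike.ofReal_mul]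

theorem inner_dyadicLp_self_index (k i : ℤ) (p q : ℝ[X]) :
    inner 𝕜 (dyadicLp 𝕜 k i p) (dyadicLp 𝕜 k i q) = ((unitIntegral (p * q) : ℝ) : 𝕜) := by
  rw [inner_dyadicLp_dyadicLp, integral_dyadicBump_mul]

theorem inner_dyadicLp_of_ne {k i i' : ℤ} (h : i ≠ i') (p q : ℝ[X]) :
    inner 𝕜 (dyadicLp 𝕜 k i p) (dyadicLp 𝕜 k i' q) = 0 := by
  rw [inner_dyadicLp_dyadicLp]
  simp only [dyadicBump_mul_of_ne h, integral_zero, RCLike.ofReal_zero]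

theorem dyadicLp_add (k i : ℤ) (p q : ℝ[X]) :
    dyadicLp 𝕜 k i (p + q) = dyadicLp 𝕜 k i p + dyadicLp 𝕜 k i q := by
  refine Lp.ext ?_
  filter_upwards [coeFn_dyadicLp 𝕜 k i (p + q), coeFn_dyadicLp 𝕜 k i p, coeFn_dyadicLp 𝕜 k i q,
    Lp.coeFn_add (dyadicLp 𝕜 k i p) (dyadicLp 𝕜 k i q)] with t h1 h2 h3 h4
  rw [h1, h4, Pi.add_apply, h2, h3, dyadicBump, unitBump_add, mul_add, RCLike.ofReal_add]
  rfl

theorem dyadicLp_smul (k i : ℤ) (c : ℝ) (p : ℝ[X]) :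
    dyadicLp 𝕜 k i (c • p) = (c : 𝕜) • dyadicLp 𝕜 k i p := by
  refine Lp.ext ?_
  filter_upwards [coeFn_dyadicLp 𝕜 k i (c • p), coeFn_dyadicLp 𝕜 k i p,
    Lp.coeFn_smul (c : 𝕜) (dyadicLp 𝕜 k i p)] with t h1 h2 h3
  rw [h1, h3, Pi.smul_apply, h2, dyadicBump, unitBump_smul, smul_eq_mul, ← RCLike.ofReal_mul,
    dyadicBump]
  congr 1
  ring

theorem dyadicLp_sum {ι : Type*} (s : Finset ι) (k i : ℤ) (c : ι → ℝ) (p : ι → ℝ[X]) :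
    dyadicLp 𝕜 k i (∑ m ∈ s, c m • p m) = ∑ m ∈ s, (c m : 𝕜) • dyadicLp 𝕜 k i (p m) := by
  let f : ℝ[X] →+ Lp 𝕜 2 (volume : Measure ℝ) :=
    AddMonoidHom.mk' (dyadicLp 𝕜 k i) (dyadicLp_add 𝕜 k i)
  refine (map_sum f _ s).trans (Finset.sum_congr rfl fun m _ => dyadicLp_smul 𝕜 k i _ _)

/-- The function on the dyadic interval `(k, i)` that is given by the polynomials `u.1` and `u.2`
on its two halves. -/
noncomputable def pairLp (k i : ℤ) (u : ℝ[X] × ℝ[X]) : Lp 𝕜 2 (volume : Measure ℝ) :=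
  (((√2)⁻¹ : ℝ) : 𝕜) • (dyadicLp 𝕜 (k + 1) (2 * i) u.1 + dyadicLp 𝕜 (k + 1) (2 * i + 1) u.2)

theorem coeFn_pairLp (k i : ℤ) (u : ℝ[X] × ℝ[X]) :
    (pairLp 𝕜 k i u : ℝ → 𝕜) =ᵐ[volume] fun t => (((√2)⁻¹ * (dyadicBump (k + 1) (2 * i) u.1 t +
      dyadicBump (k + 1) (2 * i + 1) u.2 t) : ℝ) : 𝕜) := by
  filter_upwards [coeFn_dyadicLp 𝕜 (k + 1) (2 * i) u.1, coeFn_dyadicLp 𝕜 (k + 1) (2 * i + 1) u.2,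
    Lp.coeFn_add (dyadicLp 𝕜 (k + 1) (2 * i) u.1) (dyadicLp 𝕜 (k + 1) (2 * i + 1) u.2),
    Lp.coeFn_smul (((√2)⁻¹ : ℝ) : 𝕜) (dyadicLp 𝕜 (k + 1) (2 * i) u.1 +
      dyadicLp 𝕜 (k + 1) (2 * i + 1) u.2)] with t h1 h2 h3 h4
  rw [pairLp, h4, Pi.smul_apply, h3, Pi.add_apply, h1, h2, smul_eq_mul, RCLike.ofReal_mul,
    RCLike.ofReal_add]

theorem dyadicLp_eq_pairLp (k i : ℤ) (p : ℝ[X]) :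
    dyadicLp 𝕜 k i p = pairLp 𝕜 k i (restrictHalves p) := by
  refine Lp.ext ?_
  filter_upwards [coeFn_dyadicLp 𝕜 k i p, coeFn_pairLp 𝕜 k i (restrictHalves p)] with t h1 h2
  rw [h1, h2, dyadicBump_refine]

theorem pairLp_sum {ι : Type*} (s : Finset ι) (k i : ℤ) (c : ι → ℝ) (u : ι → ℝ[X] × ℝ[X]) :
    pairLp 𝕜 k i (∑ m ∈ s, c m • u m) = ∑ m ∈ s, (c m : 𝕜) • pairLp 𝕜 k i (u m) := by
  simp only [pairLp, Prod.fst_sum, Prod.snd_sum, Prod.smul_fst, Prod.smul_snd, dyadicLp_sum]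
  rw [← Finset.sum_add_distrib, Finset.smul_sum]
  refine Finset.sum_congr rfl fun m _ => ?_
  rw [← smul_add, smul_comm]

theorem pairLp_add (k i : ℤ) (u v : ℝ[X] × ℝ[X]) :
    pairLp 𝕜 k i (u + v) = pairLp 𝕜 k i u + pairLp 𝕜 k i v := by
  simp only [pairLp, Prod.fst_add, Prod.snd_add, dyadicLp_add]
  rw [← smul_add]
  congr 1
  abel

theorem inner_pairLp_self_index (k i : ℤ) (u v : ℝ[X] × ℝ[X]) :
    inner 𝕜 (pairLp 𝕜 k i u) (pairLp 𝕜 k i v) = ((pairForm u v / 2 : ℝ) : 𝕜) := by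
  have hne : 2 * i ≠ 2 * i + 1 := by omega
  have h2 : (√2)⁻¹ * (√2)⁻¹ = (1 / 2 : ℝ) := by
    rw [← mul_inv, Real.mul_self_sqrt two_pos.le, one_div]
  simp only [pairLp, inner_smul_left, inner_smul_right, inner_add_left, inner_add_right,
    inner_dyadicLp_self_index, inner_dyadicLp_of_ne 𝕜 hne, inner_dyadicLp_of_ne 𝕜 hne.symm,
    RCLike.conj_ofReal, add_zero, zero_add]
  rw [← mul_add, ← mul_assoc, ← RCLike.ofReal_mul, ← RCLike.ofReal_add, ← RCLike.ofReal_mul, h2,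
    pairForm_apply]
  congr 1
  ring

theorem inner_pairLp_of_ne {k i i' : ℤ} (h : i ≠ i') (u v : ℝ[X] × ℝ[X]) :
    inner 𝕜 (pairLp 𝕜 k i u) (pairLp 𝕜 k i' v) = 0 := by
  have h1 : 2 * i ≠ 2 * i' := by omega
  have h2 : 2 * i ≠ 2 * i' + 1 := by omega
  have h3 : 2 * i + 1 ≠ 2 * i' := by omega
  have h4 : 2 * i + 1 ≠ 2 * i' + 1 := by omega
  simp only [pairLp, inner_smul_left, inner_smul_right, inner_add_left, inner_add_right,
    inner_dyadicLp_of_ne 𝕜 h1, inner_dyadicLp_of_ne 𝕜 h2, inner_dyadicLp_of_ne 𝕜 h3,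
    inner_dyadicLp_of_ne 𝕜 h4, add_zero, mul_zero]

/-- The wavelet `alpertWavelet n k i j` as an element of `L²`. -/
noncomputable def waveletLp (n : ℕ) (k i : ℤ) (j : Fin (n + 1)) : Lp 𝕜 2 (volume : Measure ℝ) :=
  pairLp 𝕜 k i (alpertPair n j)

theorem coeFn_waveletLp (n : ℕ) (k i : ℤ) (j : Fin (n + 1)) :
    (waveletLp 𝕜 n k i j : ℝ → 𝕜) =ᵐ[volume] fun t => ((alpertWavelet n k i j t : ℝ) : 𝕜) := by
  filter_upwards [coeFn_pairLp 𝕜 k i (alpertPair n j)] with t ht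
  rw [waveletLp, ht, alpertWavelet_eq]

/-- A wavelet is orthogonal to the polynomials of degree at most `n` on a dyadic interval of the
same or of a larger size. -/
theorem inner_dyadicLp_waveletLp {n : ℕ} (d : ℕ) (k i i' : ℤ) (j : Fin (n + 1)) {p : ℝ[X]}
    (hp : p.natDegree ≤ n) : inner 𝕜 (dyadicLp 𝕜 k i p) (waveletLp 𝕜 n (k + d) i' j) = 0 := by
  induction d generalizing k i p with
  | zero =>
    rw [Nat.cast_zero, add_zero, dyadicLp_eq_pairLp, waveletLp]
    rcases eq_or_ne i i' with rfl | h
    · rw [inner_pairLp_self_index,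
        pairForm_restrictHalves_alpertPair (Nat.lt_succ_iff.1 j.2) hp, zero_div, RCLike.ofReal_zero]
    · exact inner_pairLp_of_ne 𝕜 h _ _
  | succ d ih =>
    have e : k + ((d + 1 : ℕ) : ℤ) = (k + 1) + d := by push_cast; ring
    obtain ⟨h1, h2⟩ := natDegree_restrictHalves_le hp
    rw [e, dyadicLp_eq_pairLp, pairLp, inner_smul_left, inner_add_left, ih (k + 1) _ h1,
      ih (k + 1) _ h2, add_zero, mul_zero]

theorem inner_waveletLp_of_lt {n : ℕ} {k k' : ℤ} (h : k < k') (i i' : ℤ) (j j' : Fin (n + 1)) :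
    inner 𝕜 (waveletLp 𝕜 n k i j) (waveletLp 𝕜 n k' i' j') = 0 := by
  obtain ⟨d, rfl⟩ : ∃ d : ℕ, k' = (k + 1) + d := ⟨(k' - (k + 1)).toNat, by omega⟩
  obtain ⟨h1, h2⟩ := natDegree_alpertPair_le (n := n) (j := j)
  rw [waveletLp, pairLp, inner_smul_left, inner_add_left,
    inner_dyadicLp_waveletLp 𝕜 d _ _ _ _ h1, inner_dyadicLp_waveletLp 𝕜 d _ _ _ _ h2, add_zero,
    mul_zero]

theorem orthonormal_waveletLp (n : ℕ) : Orthonormal 𝕜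
    fun a : ℤ × ℤ × Fin (n + 1) => waveletLp 𝕜 n a.1 a.2.1 a.2.2 := by
  classical
  rw [orthonormal_iff_ite]
  rintro ⟨k, i, j⟩ ⟨k', i', j'⟩
  simp only [Prod.mk.injEq]
  rcases lt_trichotomy k k' with h | rfl | h
  · rw [inner_waveletLp_of_lt 𝕜 h, if_neg (fun hh => h.ne hh.1)]
  · rcases eq_or_ne i i' with rfl | hi
    · have hj : ((j : ℕ) = j') ↔ j = j' := Fin.ext_iff.symm
      rw [waveletLp, waveletLp, inner_pairLp_self_index,
        pairForm_alpertPair (Nat.lt_succ_iff.1 j.2) (Nat.lt_succ_iff.1 j'.2)]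
      by_cases hjj : j = j'
      · simp [hjj]
      · rw [if_neg (hj.not.2 hjj), if_neg (fun hh => hjj hh.2.2)]
        simp
    · rw [waveletLp, waveletLp, inner_pairLp_of_ne 𝕜 hi, if_neg (fun hh => hi hh.2.1)]
  · rw [← inner_conj_symm, inner_waveletLp_of_lt 𝕜 h, map_zero, if_neg (fun hh => h.ne' hh.1)]

end Lp

/-! ### Completeness -/

section Complete

variable (𝕜 : Type*) [RCLike 𝕜]

/-- The span of the wavelets of scale at least `K`. -/
noncomputable def waveletSpan (n : ℕ) (K : ℤ) : Submodule 𝕜 (Lp 𝕜 2 (volume : Measure ℝ)) :=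
  Submodule.span 𝕜 {w | ∃ k i j, K ≤ k ∧ w = waveletLp 𝕜 n k i j}

theorem waveletSpan_anti (n : ℕ) {K K' : ℤ} (h : K ≤ K') :
    waveletSpan 𝕜 n K' ≤ waveletSpan 𝕜 n K :=
  Submodule.span_mono fun _ ⟨k, i, j, hk, hw⟩ => ⟨k, i, j, h.trans hk, hw⟩

theorem inner_dyadicLp_of_mem_waveletSpan {n : ℕ} (K i : ℤ) {p : ℝ[X]} (hp : p.natDegree ≤ n)
    {w : Lp 𝕜 2 (volume : Measure ℝ)} (hw : w ∈ waveletSpan 𝕜 n K) :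
    inner 𝕜 (dyadicLp 𝕜 K i p) w = 0 := by
  have hle : waveletSpan 𝕜 n K ≤ (Submodule.span 𝕜 {dyadicLp 𝕜 K i p})ᗮ := by
    refine Submodule.span_le.2 ?_
    rintro _ ⟨k, i', j, hk, rfl⟩
    obtain ⟨d, rfl⟩ : ∃ d : ℕ, k = K + d := ⟨(k - K).toNat, by omega⟩
    exact Submodule.mem_orthogonal_singleton_iff_inner_right.2
      (inner_dyadicLp_waveletLp 𝕜 d K i i' j hp)
  exact Submodule.mem_orthogonal_singleton_iff_inner_right.1 (hle hw)

theorem natDegree_sum_legendre_le {n : ℕ} (a : Fin (n + 1) → ℝ) :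
    (∑ m, a m • alpertBasePoly m 0).natDegree ≤ n :=
  natDegree_sum_le_of_forall_le _ _ fun m _ => (natDegree_smul_le _ _).trans
    ((natDegree_alpertBasePoly_le _ _).trans (Nat.lt_succ_iff.1 m.2))

/-- A polynomial on a dyadic interval is, modulo wavelets, a polynomial on the parent interval. -/
theorem exists_dyadicLp_eq_parent {n : ℕ} (K i : ℤ) {p : ℝ[X]} (hp : p.natDegree ≤ n) :
    ∃ (i' : ℤ) (a : Fin (n + 1) → ℝ), ∃ w ∈ waveletSpan 𝕜 n K,
      dyadicLp 𝕜 (K + 1) i p = dyadicLp 𝕜 K i' (∑ m, a m • alpertBasePoly m 0) + w := by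
  have h2 : (((√2)⁻¹ : ℝ) : 𝕜) * ((√2 : ℝ) : 𝕜) = 1 := by
    rw [← RCLike.ofReal_mul, inv_mul_cancel₀ (by positivity), RCLike.ofReal_one]
  have h0 : ∀ k i : ℤ, dyadicLp 𝕜 k i 0 = 0 := fun k i => by
    simpa using dyadicLp_smul 𝕜 k i 0 0
  obtain ⟨i', u, hu1, hu2, hu⟩ : ∃ (i' : ℤ) (u : ℝ[X] × ℝ[X]), u.1.natDegree ≤ n ∧
      u.2.natDegree ≤ n ∧ dyadicLp 𝕜 (K + 1) i p = pairLp 𝕜 K i' u := by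
    have hd : (√2 • p).natDegree ≤ n := (natDegree_smul_le _ _).trans hp
    rcases Int.even_or_odd' i with ⟨c, rfl | rfl⟩
    · refine ⟨c, (√2 • p, 0), hd, by simp, ?_⟩
      rw [pairLp, h0, add_zero, dyadicLp_smul, smul_smul, h2, one_smul]
    · refine ⟨c, (0, √2 • p), by simp, hd, ?_⟩
      rw [pairLp, h0, zero_add, dyadicLp_smul, smul_smul, h2, one_smul]
  obtain ⟨a, b, hab⟩ := exists_eq_sum_restrictHalves_add_sum_alpertPair u hu1 hu2
  refine ⟨i', a, ∑ j, (b j : 𝕜) • waveletLp 𝕜 n K i' j, ?_, ?_⟩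
  · exact Submodule.sum_mem _ fun j _ => Submodule.smul_mem _ _
      (Submodule.subset_span ⟨K, i', j, le_rfl, rfl⟩)
  · rw [hu, hab, pairLp_add, pairLp_sum, pairLp_sum, dyadicLp_sum]
    simp only [dyadicLp_eq_pairLp, waveletLp]

theorem exists_dyadicLp_eq_ancestor {n : ℕ} (N : ℕ) (k i : ℤ) {p : ℝ[X]} (hp : p.natDegree ≤ n) :
    ∃ (i' : ℤ) (a : Fin (n + 1) → ℝ), ∃ w ∈ waveletSpan 𝕜 n (k - (N + 1)),
      dyadicLp 𝕜 k i p = dyadicLp 𝕜 (k - (N + 1)) i' (∑ m, a m • alpertBasePoly m 0) + w := by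
  induction N with
  | zero =>
    obtain ⟨i', a, w, hw, h⟩ := exists_dyadicLp_eq_parent 𝕜 (k - 1) i hp
    have e : k - (((0 : ℕ) : ℤ) + 1) = k - 1 := by simp
    rw [sub_add_cancel] at h
    rw [e]
    exact ⟨i', a, w, hw, h⟩
  | succ N ih =>
    obtain ⟨i', a, w, hw, h⟩ := ih
    have e : k - ((N : ℤ) + 1) = k - (((N + 1 : ℕ) : ℤ) + 1) + 1 := by push_cast; ring
    rw [e] at h hw
    obtain ⟨i'', a', w', hw', h'⟩ := exists_dyadicLp_eq_parent 𝕜 (k - (((N + 1 : ℕ) : ℤ) + 1)) i'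
      (natDegree_sum_legendre_le a)
    refine ⟨i'', a', w' + w, Submodule.add_mem _ hw' (waveletSpan_anti 𝕜 n (by omega) hw), ?_⟩
    rw [h, h', add_assoc]

theorem norm_dyadicLp_legendre (k i : ℤ) (m : ℕ) : ‖dyadicLp 𝕜 k i (alpertBasePoly m 0)‖ = 1 := by
  have h : inner 𝕜 (dyadicLp 𝕜 k i (alpertBasePoly m 0)) (dyadicLp 𝕜 k i (alpertBasePoly m 0)) =
      (1 : 𝕜) := by
    rw [inner_dyadicLp_self_index, unitIntegral_legendre_mul, if_pos rfl, RCLike.ofReal_one]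
  rw [inner_self_eq_norm_sq_to_K] at h
  have h' : ‖dyadicLp 𝕜 k i (alpertBasePoly m 0)‖ ^ 2 = 1 := by exact_mod_cast h
  exact (pow_eq_one_iff_of_nonneg (norm_nonneg _) two_ne_zero).1 h'

/-- A function that is orthogonal to all wavelets is orthogonal to the polynomials of degree at
most `n` on every dyadic interval: modulo wavelets these are polynomials on ever larger ancestors
of the interval, and the coefficients tend to `0`. -/
theorem inner_dyadicLp_eq_zero {n : ℕ} {f : Lp 𝕜 2 (volume : Measure ℝ)}
    (hf : ∀ k i j, inner 𝕜 (waveletLp 𝕜 n k i j) f = 0) (k i : ℤ) {p : ℝ[X]}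
    (hp : p.natDegree ≤ n) : inner 𝕜 (dyadicLp 𝕜 k i p) f = 0 := by
  have hspan : ∀ K, ∀ w ∈ waveletSpan 𝕜 n K, inner 𝕜 w f = 0 := by
    intro K w hw
    have hle : waveletSpan 𝕜 n K ≤ (Submodule.span 𝕜 {f})ᗮ := by
      refine Submodule.span_le.2 ?_
      rintro _ ⟨k, i, j, -, rfl⟩
      exact Submodule.mem_orthogonal_singleton_iff_inner_left.2 (hf k i j)
    exact Submodule.mem_orthogonal_singleton_iff_inner_left.1 (hle hw)
  choose M hM using fun m : Fin (n + 1) => exists_abs_unitBump_le (alpertBasePoly m 0)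
  set I : ℝ := ∫ t, |dyadicBump k i p t| with hI
  have hint : Integrable (fun t => |dyadicBump k i p t|) :=
    (memLp_one_iff_integrable.1 (memLp_dyadicBump k i p 1)).abs
  have hbound : ∀ N : ℕ, ‖inner 𝕜 (dyadicLp 𝕜 k i p) f‖ ≤
      (2 : ℝ) ^ (((k - (N + 1) : ℤ) : ℝ) / 2) * ∑ m, M m * I * ‖f‖ := by
    intro N
    obtain ⟨i', a, w, hw, h⟩ := exists_dyadicLp_eq_ancestor 𝕜 N k i hp
    have ha : ∀ m : Fin (n + 1), a m =
        ∫ t, dyadicBump (k - (N + 1)) i' (alpertBasePoly m 0) t * dyadicBump k i p t := by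
      intro m
      have hm := inner_dyadicLp_dyadicLp 𝕜 (k - (N + 1)) i' k i (alpertBasePoly m 0) p
      rw [h, inner_add_right, inner_dyadicLp_of_mem_waveletSpan 𝕜 _ _
        ((natDegree_alpertBasePoly_le _ _).trans (Nat.lt_succ_iff.1 m.2)) hw, add_zero,
        inner_dyadicLp_self_index] at hm
      rw [← RCLike.ofReal_inj (K := 𝕜), ← hm, Finset.mul_sum, map_sum]
      congr 1
      rw [Finset.sum_eq_single m]
      · rw [mul_smul_comm, map_smul, unitIntegral_legendre_mul, if_pos rfl, smul_eq_mul, mul_one]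
      · intro m' _ hne
        rw [mul_smul_comm, map_smul, unitIntegral_legendre_mul,
          if_neg (fun hh => hne (Fin.ext hh.symm)), smul_zero]
      · exact fun hm => absurd (Finset.mem_univ m) hm
    have hale : ∀ m, |a m| ≤ (2 : ℝ) ^ (((k - (N + 1) : ℤ) : ℝ) / 2) * M m * I := by
      intro m
      rw [ha m, hI, ← integral_const_mul, ← Real.norm_eq_abs]
      refine norm_integral_le_of_norm_le (hint.const_mul _) (Eventually.of_forall fun t => ?_)
      rw [Real.norm_eq_abs, abs_mul]
      exact mul_le_mul_of_nonneg_right (abs_dyadicBump_le (hM m) _ _ _) (abs_nonneg _)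
    rw [h, inner_add_left, hspan _ w hw, add_zero, dyadicLp_sum, sum_inner, Finset.mul_sum]
    refine norm_sum_le_of_le _ fun m _ => ?_
    rw [inner_smul_left, RCLike.conj_ofReal, norm_mul, RCLike.norm_ofReal]
    have h1 : ‖inner 𝕜 (dyadicLp 𝕜 (k - (N + 1)) i' (alpertBasePoly m 0)) f‖ ≤ ‖f‖ := by
      refine (norm_inner_le_norm _ _).trans ?_
      rw [norm_dyadicLp_legendre, one_mul]
    refine (mul_le_mul (hale m) h1 (norm_nonneg _) ((abs_nonneg _).trans (hale m))).trans ?_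
    exact le_of_eq (by ring)
  have hlim : Tendsto (fun N : ℕ => (2 : ℝ) ^ (((k - (N + 1) : ℤ) : ℝ) / 2) *
      ∑ m, M m * I * ‖f‖) atTop (𝓝 0) := by
    rw [← zero_mul (∑ m, M m * I * ‖f‖)]
    refine Tendsto.mul_const _ ((tendsto_rpow_atBot_of_base_gt_one 2 one_lt_two).comp ?_)
    refine Tendsto.atBot_div_const two_pos ?_
    have : ∀ N : ℕ, ((k - (N + 1) : ℤ) : ℝ) = ((k : ℝ) - 1) + -(N : ℝ) := fun N => by
      push_cast; ring
    simp only [this]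
    exact tendsto_atBot_add_const_left _ _ (tendsto_neg_atTop_atBot.comp
      tendsto_natCast_atTop_atTop)
  exact norm_le_zero_iff.1 (ge_of_tendsto' hlim hbound)

theorem inner_dyadicLp_one (k i : ℤ) (f : Lp 𝕜 2 (volume : Measure ℝ)) :
    inner 𝕜 (dyadicLp 𝕜 k i 1) f = (((2 : ℝ) ^ ((k : ℝ) / 2) : ℝ) : 𝕜) *
      ∫ t in Set.Icc ((i : ℝ) / 2 ^ k) (((i : ℝ) + 1) / 2 ^ k), f t := by
  have hk : (0 : ℝ) < 2 ^ k := zpow_pos two_pos k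
  rw [inner_dyadicLp_left, integral_Icc_eq_integral_Ico, ← integral_indicator measurableSet_Ico,
    ← integral_const_mul]
  congr 1
  ext t
  by_cases h : t ∈ Set.Ico ((i : ℝ) / 2 ^ k) (((i : ℝ) + 1) / 2 ^ k)
  · rw [Set.indicator_of_mem h]
    rw [Set.mem_Ico, div_le_iff₀ hk, lt_div_iff₀ hk] at h
    rw [dyadicBump, unitBump_of_mem (by linarith) (by linarith), eval_one, mul_one]
  · rw [Set.indicator_of_notMem h]
    rw [Set.mem_Ico, div_le_iff₀ hk, lt_div_iff₀ hk, not_and_or, not_le, not_lt] at h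
    rcases h with h | h
    · rw [dyadicBump, unitBump_of_neg (by linarith), mul_zero, RCLike.ofReal_zero, zero_mul,
        mul_zero]
    · rw [dyadicBump, unitBump_of_one_le (by linarith), mul_zero, RCLike.ofReal_zero, zero_mul,
        mul_zero]

/-- A locally integrable function whose integrals over all dyadic intervals vanish is `0`, by
Lebesgue's differentiation theorem along the dyadic intervals that contain a given point. -/
theorem ae_eq_zero_of_dyadic {f : ℝ → 𝕜} (hf : LocallyIntegrable f volume)
    (h : ∀ k i : ℤ, ∫ t in Set.Icc ((i : ℝ) / 2 ^ k) (((i : ℝ) + 1) / 2 ^ k), f t = 0) :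
    f =ᵐ[volume] 0 := by
  filter_upwards [IsUnifLocDoublingMeasure.ae_tendsto_average (μ := volume) hf 1] with x hx
  have hpos : ∀ k : ℕ, (0 : ℝ) < 2 ^ k := fun k => pow_pos two_pos k
  have hball : ∀ k : ℕ, Metric.closedBall (((⌊2 ^ k * x⌋ : ℝ) + 1 / 2) / 2 ^ k) ((1 / 2) / 2 ^ k) =
      Set.Icc ((⌊2 ^ k * x⌋ : ℝ) / 2 ^ (k : ℤ)) (((⌊2 ^ k * x⌋ : ℝ) + 1) / 2 ^ (k : ℤ)) := by
    intro k
    rw [Real.closedBall_eq_Icc, ← sub_div, ← add_div, zpow_natCast]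
    congr 2 <;> ring
  have hδ : Tendsto (fun k : ℕ => (1 / 2 : ℝ) / 2 ^ k) atTop (𝓝[>] 0) := by
    refine tendsto_nhdsWithin_iff.2 ⟨?_, Eventually.of_forall fun k => ?_⟩
    · have := (tendsto_pow_atTop_nhds_zero_of_lt_one (r := (1 / 2 : ℝ)) (by norm_num)
        (by norm_num)).const_mul (1 / 2)
      simpa [div_eq_mul_inv] using this
    · exact div_pos (by norm_num) (hpos k)
  have hmem : ∀ᶠ k : ℕ in atTop, x ∈ Metric.closedBall (((⌊2 ^ k * x⌋ : ℝ) + 1 / 2) / 2 ^ k)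
      (1 * ((1 / 2) / 2 ^ k)) := by
    refine Eventually.of_forall fun k => ?_
    rw [one_mul, hball, zpow_natCast, Set.mem_Icc, div_le_iff₀ (hpos k), le_div_iff₀ (hpos k),
      mul_comm x]
    exact ⟨Int.floor_le _, (Int.lt_floor_add_one _).le⟩
  have hlim := hx _ _ hδ hmem
  have hzero : ∀ k : ℕ, ⨍ y in Metric.closedBall (((⌊2 ^ k * x⌋ : ℝ) + 1 / 2) / 2 ^ k)
      ((1 / 2) / 2 ^ k), f y = 0 := by
    intro k
    rw [setAverage_eq, hball, h, smul_zero]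
  simp only [hzero] at hlim
  exact (tendsto_nhds_unique hlim tendsto_const_nhds)

theorem orthogonal_span_waveletLp (n : ℕ) : (Submodule.span 𝕜 (Set.range
    fun a : ℤ × ℤ × Fin (n + 1) => waveletLp 𝕜 n a.1 a.2.1 a.2.2))ᗮ = ⊥ := by
  rw [eq_bot_iff]
  intro f hf
  rw [Submodule.mem_bot]
  have hw : ∀ k i j, inner 𝕜 (waveletLp 𝕜 n k i j) f = 0 := fun k i j =>
    (Submodule.mem_orthogonal _ _).1 hf _ (Submodule.subset_span ⟨(k, i, j), rfl⟩)
  refine Lp.ext ((ae_eq_zero_of_dyadic 𝕜 ((Lp.memLp f).locallyIntegrable one_le_two)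
    fun k i => ?_).trans (Lp.coeFn_zero _ _ _).symm)
  have h := inner_dyadicLp_eq_zero 𝕜 hw k i (p := 1) (by simp)
  rw [inner_dyadicLp_one] at h
  exact (mul_eq_zero.1 h).resolve_left
    (RCLike.ofReal_ne_zero.2 (Real.rpow_pos_of_pos two_pos _).ne')

end Complete

/-! ### Compact support and piecewise polynomials -/

theorem IsPiecewisePolynomial.add {f g : ℝ → ℝ} (hf : IsPiecewisePolynomial f)
    (hg : IsPiecewisePolynomial g) : IsPiecewisePolynomial fun t => f t + g t := by
  obtain ⟨S, hS⟩ := hf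
  obtain ⟨T, hT⟩ := hg
  classical
  refine ⟨S ∪ T, fun a b hab h => ?_⟩
  obtain ⟨p, hp⟩ := hS a b hab fun s hs => h s (Finset.mem_union_left _ hs)
  obtain ⟨q, hq⟩ := hT a b hab fun s hs => h s (Finset.mem_union_right _ hs)
  exact ⟨p + q, fun t ht => by simp only [eval_add, hp t ht, hq t ht]⟩

theorem IsPiecewisePolynomial.const_mul {f : ℝ → ℝ} (hf : IsPiecewisePolynomial f) (c : ℝ) :
    IsPiecewisePolynomial fun t => c * f t := by
  obtain ⟨S, hS⟩ := hf
  refine ⟨S, fun a b hab h => ?_⟩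
  obtain ⟨p, hp⟩ := hS a b hab h
  exact ⟨C c * p, fun t ht => by simp only [eval_mul, eval_C, hp t ht]⟩

theorem isPiecewisePolynomial_dyadicBump (k i : ℤ) (p : ℝ[X]) :
    IsPiecewisePolynomial (dyadicBump k i p) := by
  have hk : (0 : ℝ) < 2 ^ k := zpow_pos two_pos k
  refine ⟨{(i : ℝ) / 2 ^ k, ((i : ℝ) + 1) / 2 ^ k}, fun a b hab h => ?_⟩
  have h1 := h ((i : ℝ) / 2 ^ k) (by simp)
  have h2 := h (((i : ℝ) + 1) / 2 ^ k) (by simp)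
  rw [Set.mem_Ioo, not_and_or, not_lt, not_lt] at h1 h2
  rw [div_le_iff₀ hk, le_div_iff₀ hk] at h1 h2
  have hle : ∀ {t s : ℝ}, t ≤ s → t * 2 ^ k ≤ s * 2 ^ k := fun hts =>
    mul_le_mul_of_nonneg_right hts hk.le
  have hlt : ∀ {t s : ℝ}, t < s → t * 2 ^ k < s * 2 ^ k := fun hts =>
    mul_lt_mul_of_pos_right hts hk
  rcases h1 with h1 | h1
  · rcases h2 with h2 | h2
    · refine ⟨0, fun t ht => ?_⟩
      have := hle ht.1
      rw [dyadicBump, unitBump_of_one_le (by linarith), mul_zero, eval_zero]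
    · refine ⟨C ((2 : ℝ) ^ ((k : ℝ) / 2)) * p.comp (C ((2 : ℝ) ^ k) * X - C (i : ℝ)),
        fun t ht => ?_⟩
      have h3 := hle ht.1
      have h4 := hlt ht.2
      rw [dyadicBump, unitBump_of_mem (by linarith) (by linarith), eval_mul, eval_C, eval_comp,
        eval_sub, eval_mul, eval_C, eval_X, eval_C]
  · refine ⟨0, fun t ht => ?_⟩
    have := hlt ht.2
    rw [dyadicBump, unitBump_of_neg (by linarith), mul_zero, eval_zero]

theorem isPiecewisePolynomial_alpertWavelet (n : ℕ) (k i : ℤ) (j : Fin (n + 1)) :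
    IsPiecewisePolynomial (alpertWavelet n k i j) := by
  rw [funext (alpertWavelet_eq n k i j)]
  exact ((isPiecewisePolynomial_dyadicBump _ _ _).add
    (isPiecewisePolynomial_dyadicBump _ _ _)).const_mul _

theorem hasCompactSupport_alpertWavelet (n : ℕ) (k i : ℤ) (j : Fin (n + 1)) :
    HasCompactSupport (alpertWavelet n k i j) := by
  refine HasCompactSupport.intro ((isCompact_Icc (a := ((2 * i : ℤ) : ℝ) / 2 ^ (k + 1))
    (b := (((2 * i : ℤ) : ℝ) + 1) / 2 ^ (k + 1))).union
    (isCompact_Icc (a := ((2 * i + 1 : ℤ) : ℝ) / 2 ^ (k + 1))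
      (b := (((2 * i + 1 : ℤ) : ℝ) + 1) / 2 ^ (k + 1)))) fun t ht => ?_
  rw [Set.mem_union, not_or] at ht
  rw [alpertWavelet_eq, dyadicBump_eq_zero ht.1, dyadicBump_eq_zero ht.2, add_zero, mul_zero]

end

theorem theorem2 (𝕜 : Type*) [RCLike 𝕜] (n : ℕ) :
    (∀ (k i : ℤ) (j : Fin (n + 1)),
      HasCompactSupport (alpertWavelet n k i j) ∧ IsPiecewisePolynomial (alpertWavelet n k i j)) ∧
    ∃ b : HilbertBasis (ℤ × ℤ × Fin (n + 1)) 𝕜 (Lp 𝕜 2 (volume : Measure ℝ)),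
      ∀ (k i : ℤ) (j : Fin (n + 1)),
        (b (k, i, j) : ℝ → 𝕜) =ᵐ[volume] fun t => ((alpertWavelet n k i j t : ℝ) : 𝕜) := by
  refine ⟨fun k i j => ⟨hasCompactSupport_alpertWavelet n k i j,
    isPiecewisePolynomial_alpertWavelet n k i j⟩,
    HilbertBasis.mkOfOrthogonalEqBot (orthonormal_waveletLp 𝕜 n) (orthogonal_span_waveletLp 𝕜 n),
    fun k i j => ?_⟩
  rw [HilbertBasis.coe_mkOfOrthogonalEqBot]
  exact coeFn_waveletLp 𝕜 n k i j
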